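/- Let $G$ be a locally compact Hausdorff étale groupoid, let $\Sigma$ be a locally compact Hausdorff topological groupoid, and let $\mathbb T\times G^{(0)}\xrightarrow{\iota}\Sigma\xrightarrow{q}G$ be a twist: a sequence of continuous groupoid homomorphisms, $\iota$ injective and $q$ surjective, restricting to homeomorphisms $\{1\}\times G^{(0)}\to\Sigma^{(0)}$ and $\Sigma^{(0)}\to G^{(0)}$ (used to identify the unit spaces), with $q^{-1}(G^{(0)})=\iota(\mathbb T\times G^{(0)})$, with $\iota(z,r(\gamma))\gamma=\gamma\,\iota(z,s(\gamma))=:z\cdot\gamma$ for all $z\in\mathbb T$, $\gamma\in\Sigma$, and locally trivial: every $g\in G$ lies in an open bisection $U$ that admits a continuous section $\phi:U\to\Sigma$ of $q$ such that $(z,h)\mapsto z\cdot\phi(h)$ is a homeomorphism of $\mathbb T\times U$ onto $q^{-1}(U)$. Let $L=(\mathbb C\times\Sigma)/\mathbb T$ be the associated complex line bundle over $G$, where $[\lambda,z\cdot\gamma]=[z\lambda,\gamma]$, with projection $[\lambda,\gamma]\mapsto q(\gamma)$, absolute value $|[\lambda,\gamma]|=|\lambda|$, fibrewise linear structure $[\lambda,\gamma]+[\mu,\gamma]=[\lambda+\mu,\gamma]$,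 partial product $[\lambda,\gamma][\lambda',\gamma']=[\lambda\lambda',\gamma\gamma']$ for composable $\gamma,\gamma'$, and involution $\overline{[\lambda,\gamma]}=[\overline\lambda,\gamma^{-1}]$. Let $C_c(\Sigma;G)$ and $C_0(\Sigma;G)$ be the spaces of continuous sections $f$ of $L$ for which $|f|$ has compact support, respectively vanishes at infinity; $C_0(\Sigma;G)$ carries the norm $\|f\|_\infty=\sup_{g\in G}|f(g)|$, and $C_c(\Sigma;G)$ is a $*$-algebra under $(f*h)(g)=\sum_{r(\eta)=r(g)}f(\eta)h(\eta^{-1}g)$ and $f^*(g)=\overline{f(g^{-1})}$. For $x\in G^{(0)}$ let $\pi_x$ be the regular representation of $C_c(\Sigma;G)$ on the Hilbert space of square-summable sections of $L$ over $Gx=\{g\in G:s(g)=x\}$, given by $(\pi_x(f)\chi)(g)=\sum_{\zeta\in Gx}f(g\zeta^{-1})\chi(\zeta)$, and let $C^*_r(\Sigma;G)$ be the $C^*$-algebra obtained by completing $C_c(\Sigma;G)$ in the norm $\|f\|_r=\sup_{x\in G^{(0)}}\|\pi_x(f)\|$. Then the inclusion $C_c(\Sigma;G)\to C_0(\Sigma;G)$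 extends to an injective linear map $j:C^*_r(\Sigma;G)\to C_0(\Sigma;G)$ with $\|j(a)\|_\infty\le\|a\|$ for all $a\in C^*_r(\Sigma;G)$. Moreover, for all $a,b\in C^*_r(\Sigma;G)$ and $g\in G$, $$j(a^*)(g)=\overline{j(a)(g^{-1})}\qquad\text{and}\qquad j(ab)(g)=\sum_{r(\eta)=r(g)}j(a)(\eta)\,j(b)(\eta^{-1}g),$$ where the (possibly infinite) sum converges unconditionally in the fibre of $L$ over $g$. -/

import Mathlib

open Topology Filter

namespace TwistedGroupoid

noncomputable section

/-- A groupoid, given by its set `G` of arrows (objects are identified with unit arrows).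
The product `mul a b` is meaningful only when `src a = rng b`; no law constrains the value of the
total function `mul` elsewhere, and that value is never used. -/
class Gpd (G : Type*) where
  src : G → G
  rng : G → G
  inv : G → G
  mul : G → G → G
  src_src : ∀ a, src (src a) = src a
  rng_src : ∀ a, rng (src a) = src a
  src_rng : ∀ a, src (rng a) = rng a
  rng_rng : ∀ a, rng (rng a) = rng a
  src_mul : ∀ a b, src a = rng b → src (mul a b) = src b
  rng_mul : ∀ a b, src a = rng b → rng (mul a b) = rng a
  assoc : ∀ a b c, src a = rng b → src b = rng c → mul (mul a b) c = mul a (mul b c)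
  mul_src : ∀ a, mul a (src a) = a
  rng_mul_self : ∀ a, mul (rng a) a = a
  src_inv : ∀ a, src (inv a) = rng a
  rng_inv : ∀ a, rng (inv a) = src a
  inv_mul_self : ∀ a, mul (inv a) a = src a
  mul_inv_self : ∀ a, mul a (inv a) = rng a

open Gpd

/-- The unit space of a groupoid, a subset of the set of arrows. -/
def unitSpace (G : Type*) [Gpd G] : Set G := {x | src x = x}

section Algebra

variable {G : Type*} [Gpd G]

theorem rng_unit {x : G} (h : src x = x) : rng x = x := by
  rw [← h, rng_src]

theorem inv_mul_cancel_left {a b : G} (h : src a = rng b) : mul (inv a) (mul a b) = b := by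
  rw [← assoc _ _ _ (src_inv a) h, inv_mul_self, h, rng_mul_self]

theorem mul_inv_cancel_left {a b : G} (h : rng a = rng b) : mul a (mul (inv a) b) = b := by
  rw [← assoc _ _ _ (rng_inv a).symm ((src_inv a).trans h), mul_inv_self, h, rng_mul_self]

theorem mul_inv_cancel_right {a b : G} (h : src a = rng b) : mul (mul a b) (inv b) = a := by
  rw [assoc _ _ _ h (rng_inv b).symm, mul_inv_self, ← h, mul_src]

theorem inv_mul_cancel_right {a b : G} (h : src a = src b) : mul (mul a (inv b)) b = a := by
  rw [assoc _ _ _ (h.trans (rng_inv b).symm) (src_inv b), inv_mul_self, ← h, mul_src]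

theorem inv_unique {a b : G} (h : src a = rng b) (h' : mul a b = rng a) : b = inv a := by
  have := inv_mul_cancel_left h
  rw [h', ← src_inv, mul_src] at this
  exact this.symm

theorem inv_inv (a : G) : inv (inv a) = a :=
  (inv_unique (src_inv a) (by rw [inv_mul_self, rng_inv])).symm

theorem inv_mul_rev {a b : G} (h : src a = rng b) : inv (mul a b) = mul (inv b) (inv a) := by
  have h1 : src (inv b) = rng (inv a) := by rw [src_inv, rng_inv, h]
  refine (inv_unique ?_ ?_).symm
  · rw [src_mul _ _ h, rng_mul _ _ h1, rng_inv]
  · rw [← assoc _ _ _ ((src_mul _ _ h).trans (rng_inv b).symm) h1, mul_inv_cancel_right h,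
      mul_inv_self, rng_mul _ _ h]

theorem inv_unit {x : G} (h : src x = x) : inv x = x := by
  refine (inv_unique (h.trans (rng_unit h).symm) ?_).symm
  conv_lhs => arg 2; rw [← h]
  rw [mul_src, rng_unit h]

/-- The source map, with values in the unit space. -/
def srcU (g : G) : unitSpace G := ⟨src g, src_src g⟩

/-- The range map, with values in the unit space. -/
def rngU (g : G) : unitSpace G := ⟨rng g, src_rng g⟩

/-- The product groupoid `𝕋 × G⁽⁰⁾`: two elements are composable iff their second entries agree,
and then `(z, x) (w, x) = (z w, x)`. -/
instance circleProd : Gpd (Circle × unitSpace G) where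
  src p := (1, p.2)
  rng p := (1, p.2)
  inv p := (p.1⁻¹, p.2)
  mul p p' := (p.1 * p'.1, p.2)
  src_src _ := rfl
  rng_src _ := rfl
  src_rng _ := rfl
  rng_rng _ := rfl
  src_mul _ _ h := h
  rng_mul _ _ _ := rfl
  assoc a b c _ _ := by simp [mul_assoc]
  mul_src a := by simp
  rng_mul_self a := by simp
  src_inv _ := rfl
  rng_inv _ := rfl
  inv_mul_self a := by simp
  mul_inv_self a := by simp

end Algebra

/-- A topological groupoid: inversion and composition are continuous. -/
class TopGpd (G : Type*) [TopologicalSpace G] extends Gpd G where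
  continuous_inv : Continuous (inv : G → G)
  continuousOn_mul : ContinuousOn (fun p : G × G => mul p.1 p.2) {p | src p.1 = rng p.2}

/-- Open bisections: open sets `B` such that `s|_B` and `r|_B` are homeomorphisms onto open subsets
of the unit space. -/
def IsOpenBisection {G : Type*} [TopologicalSpace G] [Gpd G] (B : Set G) : Prop :=
  IsOpen B ∧ IsOpenEmbedding (fun b : B => srcU (b : G)) ∧
    IsOpenEmbedding (fun b : B => rngU (b : G))

/-- Étale groupoids: topological groupoids whose topology has a basis of open bisections. -/
class EtaleGpd (G : Type*) [TopologicalSpace G] extends TopGpd G where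
  isTopologicalBasis_bisections : TopologicalSpace.IsTopologicalBasis {B : Set G | IsOpenBisection B}

/-- A groupoid homomorphism (a functor). -/
structure IsGpdHom {G H : Type*} [Gpd G] [Gpd H] (f : G → H) : Prop where
  map_src : ∀ a, f (src a) = src (f a)
  map_rng : ∀ a, f (rng a) = rng (f a)
  map_mul : ∀ a b, src a = rng b → f (mul a b) = mul (f a) (f b)

/-- A twist `𝕋 × G⁽⁰⁾ → S → G` over the étale groupoid `G`. -/
structure Twist (S G : Type*) [TopologicalSpace S] [TopologicalSpace G] [TopGpd S]
    [EtaleGpd G] where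
  ι : Circle × unitSpace G → S
  q : S → G
  continuous_ι : Continuous ι
  continuous_q : Continuous q
  hom_ι : IsGpdHom ι
  hom_q : IsGpdHom q
  injective_ι : Function.Injective ι
  surjective_q : Function.Surjective q
  /-- `ι` restricts to a homeomorphism of `{1} × G⁽⁰⁾` onto the unit space of `S`. -/
  isEmbedding_ι_unit : IsEmbedding (fun x : unitSpace G => ι (1, x))
  range_ι_unit : Set.range (fun x : unitSpace G => ι (1, x)) = unitSpace S
  /-- `q` restricts to a homeomorphism of the unit space of `S` onto that of `G`. -/
  isEmbedding_q_unit : IsEmbedding (fun x : unitSpace S => q x)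
  range_q_unit : Set.range (fun x : unitSpace S => q x) = unitSpace G
  /-- Under these homeomorphisms the two unit spaces are identified consistently. -/
  q_ι_unit : ∀ x : unitSpace G, q (ι (1, x)) = x
  /-- Exactness in the middle. -/
  preimage_unitSpace : q ⁻¹' unitSpace G = Set.range ι
  /-- The extension is central. -/
  central : ∀ (z : Circle) (γ : S),
    mul (ι (z, rngU (q γ))) γ = mul γ (ι (z, srcU (q γ)))
  /-- The extension is locally trivial. -/
  locallyTrivial : ∀ g : G, ∃ U : Set G, IsOpenBisection U ∧ g ∈ U ∧ ∃ φ : U → S,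
    Continuous φ ∧ (∀ h : U, q (φ h) = h) ∧
      IsEmbedding (fun p : Circle × U => mul (ι (p.1, rngU (p.2 : G))) (φ p.2)) ∧
      Set.range (fun p : Circle × U => mul (ι (p.1, rngU (p.2 : G))) (φ p.2)) = q ⁻¹' U

namespace Twist

variable {S G : Type*} [TopologicalSpace S] [TopologicalSpace G] [TopGpd S] [EtaleGpd G]
  (T : Twist S G)

/-- The action `z · γ = ι(z, r(γ)) γ` of the circle on `S`. -/
def act (z : Circle) (γ : S) : S := mul (T.ι (z, rngU (T.q γ))) γ

theorem src_ι (z : Circle) (x : unitSpace G) : src (T.ι (z, x)) = T.ι (1, x) :=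
  (T.hom_ι.map_src (z, x)).symm

theorem rng_ι (z : Circle) (x : unitSpace G) : rng (T.ι (z, x)) = T.ι (1, x) :=
  (T.hom_ι.map_rng (z, x)).symm

theorem unit_eq {e : S} (h : src e = e) (x : unitSpace G) (hx : T.q e = x) : T.ι (1, x) = e := by
  have : e ∈ unitSpace S := h
  rw [← T.range_ι_unit] at this
  obtain ⟨y, rfl⟩ := this
  rw [T.q_ι_unit] at hx
  rw [Subtype.ext hx]

theorem ι_rng (γ : S) : T.ι (1, rngU (T.q γ)) = rng γ :=
  T.unit_eq (src_rng γ) _ (T.hom_q.map_rng γ)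

theorem ι_src (γ : S) : T.ι (1, srcU (T.q γ)) = src γ :=
  T.unit_eq (src_src γ) _ (T.hom_q.map_src γ)

theorem composable_iff (γ η : S) : src γ = rng η ↔ src (T.q γ) = rng (T.q η) := by
  refine ⟨fun h => by rw [← T.hom_q.map_src, h, T.hom_q.map_rng], fun h => ?_⟩
  rw [← T.ι_src, ← T.ι_rng]
  congr 2
  exact Subtype.ext h

theorem act_comp (z : Circle) (γ : S) : src (T.ι (z, rngU (T.q γ))) = rng γ := by
  rw [src_ι, ι_rng]

theorem q_ι (z : Circle) (x : unitSpace G) : T.q (T.ι (z, x)) = x := by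
  have h : T.q (T.ι (z, x)) ∈ unitSpace G := by
    have : T.ι (z, x) ∈ T.q ⁻¹' unitSpace G := by rw [T.preimage_unitSpace]; exact ⟨_, rfl⟩
    exact this
  rw [← T.q_ι_unit x, ← T.src_ι z, T.hom_q.map_src]
  exact h.symm

theorem q_act (z : Circle) (γ : S) : T.q (T.act z γ) = T.q γ := by
  rw [act, T.hom_q.map_mul _ _ (T.act_comp z γ), q_ι]
  exact rng_mul_self _

theorem src_act (z : Circle) (γ : S) : src (T.act z γ) = src γ := src_mul _ _ (T.act_comp z γ)

theorem rng_act (z : Circle) (γ : S) : rng (T.act z γ) = rng γ := by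
  rw [act, rng_mul _ _ (T.act_comp z γ), rng_ι, ι_rng]

theorem act_one (γ : S) : T.act 1 γ = γ := by
  rw [act, ι_rng, rng_mul_self]

theorem act_act (z w : Circle) (γ : S) : T.act z (T.act w γ) = T.act (z * w) γ := by
  have h : src (T.ι (z, rngU (T.q γ))) = rng (T.ι (w, rngU (T.q γ))) := by rw [src_ι, rng_ι]
  rw [act, q_act]
  simp only [act]
  rw [← assoc _ _ _ h (T.act_comp w γ),
    show T.ι (z * w, rngU (T.q γ)) = mul _ _ from
      T.hom_ι.map_mul (z, rngU (T.q γ)) (w, rngU (T.q γ)) rfl]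

theorem act_mul (z : Circle) {γ η : S} (h : src γ = rng η) :
    T.act z (mul γ η) = mul (T.act z γ) η := by
  have hr : rngU (T.q (mul γ η)) = rngU (T.q γ) := by
    apply Subtype.ext
    change rng _ = rng _
    rw [← T.hom_q.map_rng, rng_mul _ _ h, T.hom_q.map_rng]
  rw [act, act, hr, assoc _ _ _ (T.act_comp z γ) h]

theorem mul_act (z : Circle) {γ η : S} (h : src γ = rng η) :
    mul γ (T.act z η) = T.act z (mul γ η) := by
  have hr : rngU (T.q η) = srcU (T.q γ) :=
    Subtype.ext ((T.composable_iff γ η).1 h).symm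
  rw [act_mul _ _ h]
  unfold act
  rw [T.central z γ, hr, assoc _ _ _ (by rw [rng_ι, ι_src]) (by rw [src_ι, ι_src, h])]

theorem act_injective (γ : S) : Function.Injective fun z => T.act z γ := by
  intro z w h
  have h' := congrArg (fun t => mul t (inv γ)) h
  simp only [act] at h'
  rw [mul_inv_cancel_right (T.act_comp z γ), mul_inv_cancel_right (T.act_comp w γ)] at h'
  exact congrArg Prod.fst (T.injective_ι h')

theorem exists_act {γ η : S} (h : T.q γ = T.q η) : ∃ z, T.act z γ = η := by
  have h1 : src η = src γ := by rw [← ι_src T, ← ι_src T, h]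
  have h2 : src η = rng (inv γ) := by rw [rng_inv, h1]
  have h3 : mul η (inv γ) ∈ T.q ⁻¹' unitSpace G := by
    have h4 : T.q (mul η (inv γ)) = rng (T.q η) := by
      rw [T.hom_q.map_mul _ _ h2, ← h]
      have : T.q (inv γ) = inv (T.q γ) := by
        apply inv_unique
        · rw [← T.hom_q.map_src, ← T.hom_q.map_rng, rng_inv]
        · rw [← T.hom_q.map_mul _ _ (rng_inv γ).symm, mul_inv_self, T.hom_q.map_rng]
      rw [this, mul_inv_self]
    rw [Set.mem_preimage, h4]
    exact src_rng _
  rw [T.preimage_unitSpace] at h3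
  obtain ⟨⟨z, x⟩, hz⟩ := h3
  refine ⟨z, ?_⟩
  have hx : x = rngU (T.q γ) := by
    apply Subtype.ext
    rw [← T.q_ι z x, ← T.q_ι 1 (rngU _), ι_rng, hz, ← src_inv γ, ← src_mul _ _ h2, ← hz, src_ι,
      q_ι, q_ι]
  rw [act, ← hx, hz, inv_mul_cancel_right h1]

theorem q_inv (γ : S) : T.q (inv γ) = inv (T.q γ) := by
  apply inv_unique
  · rw [← T.hom_q.map_src, ← T.hom_q.map_rng, rng_inv]
  · rw [← T.hom_q.map_mul _ _ (rng_inv γ).symm, mul_inv_self, T.hom_q.map_rng]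

theorem inv_act (z : Circle) (γ : S) : inv (T.act z γ) = T.act z⁻¹ (inv γ) := by
  have h : src γ = rng (inv γ) := (rng_inv γ).symm
  have h' : src (T.act z γ) = rng (T.act z⁻¹ (inv γ)) := by rw [src_act, rng_act, rng_inv]
  refine (inv_unique h' ?_).symm
  rw [mul_act _ _ (by rw [src_act, rng_inv]), ← act_mul _ _ h, act_act, inv_mul_cancel, act_one,
    rng_act, mul_inv_self]

/-- `(λ, γ) ~ (λ₁, γ₁)` iff `(λ₁, γ₁) = (z̄ λ, z · γ)` for some `z` in the circle. -/
def lineSetoid : Setoid (ℂ × S) where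
  r a b := ∃ z : Circle, b = (starRingEnd ℂ (z : ℂ) * a.1, T.act z a.2)
  iseqv :=
    { refl := fun a => ⟨1, by simp [act_one]⟩
      symm := by
        rintro a _ ⟨z, rfl⟩
        refine ⟨z⁻¹, Prod.ext ?_ ?_⟩
        · simp [← Circle.coe_inv_eq_conj]
        · simp [act_act, act_one]
      trans := by
        rintro a _ _ ⟨z, rfl⟩ ⟨w, rfl⟩
        exact ⟨w * z, by simp [act_act, mul_assoc]⟩ }

/-- The line bundle `L = (ℂ × S) / 𝕋`. -/
def LineBundle : Type _ := Quotient T.lineSetoid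

/-- `L` carries the quotient topology. -/
instance : TopologicalSpace T.LineBundle :=
  inferInstanceAs (TopologicalSpace (Quotient T.lineSetoid))

/-- The class `[λ, γ]` in `L`. -/
def cls (c : ℂ) (γ : S) : T.LineBundle := Quotient.mk T.lineSetoid (c, γ)

theorem cls_eq_iff {c d : ℂ} {γ η : S} : T.cls c γ = T.cls d η ↔
    ∃ z : Circle, d = starRingEnd ℂ (z : ℂ) * c ∧ η = T.act z γ := by
  refine Quotient.eq.trans ?_
  exact exists_congr fun z => Prod.ext_iff

theorem cls_act (c : ℂ) (z : Circle) (γ : S) : T.cls c (T.act z γ) = T.cls (z * c) γ :=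
  (T.cls_eq_iff.2 ⟨z, by simp [← Circle.coe_inv_eq_conj], rfl⟩).symm

theorem cls_injective (γ : S) : Function.Injective fun c => T.cls c γ := by
  intro c d h
  obtain ⟨z, rfl, hz⟩ := T.cls_eq_iff.1 h
  have : z = 1 := T.act_injective γ (by simp [← hz, act_one])
  simp [this]

/-- The bundle projection `P [λ, γ] = q γ`. -/
def proj : T.LineBundle → G :=
  Quotient.lift (fun a => T.q a.2) (by rintro a _ ⟨z, rfl⟩; exact (T.q_act z a.2).symm)

/-- The map `ϖ [λ, γ] = |λ|`. -/
def absL : T.LineBundle → ℝ :=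
  Quotient.lift (fun a => ‖a.1‖) (by rintro a _ ⟨z, rfl⟩; simp [Circle.norm_coe])

/-- The partially defined product `[λ, γ] [λ', γ'] = [λ λ', γ γ']` on `L`, for composable
`γ`, `γ'`.  (It is given the value `[0, γ]` otherwise, which is never used.) -/
def mulL : T.LineBundle → T.LineBundle → T.LineBundle := by
  classical
  exact Quotient.lift₂ (fun a b => if src a.2 = rng b.2 then T.cls (a.1 * b.1) (mul a.2 b.2)
      else T.cls 0 a.2) (by
    rintro ⟨a, γ⟩ ⟨b, η⟩ _ _ ⟨z, rfl⟩ ⟨w, rfl⟩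
    simp only [src_act, rng_act]
    split_ifs with h
    · rw [mul_act _ _ (by rw [src_act, h]), cls_act, ← act_mul _ _ h, cls_act]
      congr 1
      rw [← Circle.coe_inv_eq_conj, ← Circle.coe_inv_eq_conj]
      have h1 : (z : ℂ) ≠ 0 := z.coe_ne_zero
      have h2 : (w : ℂ) ≠ 0 := w.coe_ne_zero
      simp only [Circle.coe_inv]
      field_simp
    · rw [cls_act]; simp)

/-- The involution `[λ, γ] ↦ [λ̄, γ⁻¹]` on `L`. -/
def conjL : T.LineBundle → T.LineBundle :=
  Quotient.lift (fun a => T.cls (starRingEnd ℂ a.1) (inv a.2)) (by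
    rintro ⟨a, γ⟩ _ ⟨z, rfl⟩
    simp only [inv_act, cls_act, map_mul, Circle.coe_inv_eq_conj, Complex.conj_conj]
    rw [← mul_assoc, ← Circle.coe_inv_eq_conj, ← Circle.coe_mul]
    simp)

@[simp] theorem proj_cls (c : ℂ) (γ : S) : T.proj (T.cls c γ) = T.q γ := rfl

@[simp] theorem absL_cls (c : ℂ) (γ : S) : T.absL (T.cls c γ) = ‖c‖ := rfl

theorem mulL_cls (c d : ℂ) {γ η : S} (h : src γ = rng η) :
    T.mulL (T.cls c γ) (T.cls d η) = T.cls (c * d) (mul γ η) := if_pos h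

theorem conjL_cls (c : ℂ) (γ : S) : T.conjL (T.cls c γ) = T.cls (starRingEnd ℂ c) (inv γ) := rfl

theorem exists_cls {l : T.LineBundle} {γ : S} (h : T.q γ = T.proj l) : ∃ c, T.cls c γ = l := by
  obtain ⟨⟨c, η⟩, rfl⟩ := Quotient.exists_rep l
  obtain ⟨z, hz⟩ := T.exists_act h
  refine ⟨z * c, ?_⟩
  rw [← cls_act, hz]
  rfl

/-- The fibre `P⁻¹(g)` of the line bundle. -/
@[ext]
structure Fiber (g : G) where
  val : T.LineBundle
  proj_val : T.proj val = g

/-- For `q γ = g`, the bijection `λ ↦ [λ, γ]` of `ℂ` with the fibre over `g`, read backwards. -/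
def coordEquiv {g : G} (γ : S) (h : T.q γ = g) : T.Fiber g ≃ ℂ :=
  (Equiv.ofBijective (fun c => (⟨T.cls c γ, h⟩ : T.Fiber g))
    ⟨fun _ _ hc => T.cls_injective γ (congrArg Fiber.val hc), fun a => by
      obtain ⟨c, hc⟩ := T.exists_cls (h.trans a.proj_val.symm)
      exact ⟨c, Fiber.ext hc⟩⟩).symm

/-- A choice of representatives. -/
def lift (g : G) : S := Function.surjInv T.surjective_q g

theorem q_lift (g : G) : T.q (T.lift g) = g := Function.surjInv_eq T.surjective_q g

section FiberStructure

variable {T} {g : G}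

/-- The fibres are complex lines: `[λ, γ] + [μ, γ] = [λ + μ, γ]`, `c [λ, γ] = [c λ, γ]`.
This does not depend on `γ`, see `fmk_add_fmk` and `smul_fmk` below. -/
instance : AddCommGroup (T.Fiber g) := (T.coordEquiv (T.lift g) (T.q_lift g)).addCommGroup

instance : Module ℂ (T.Fiber g) := (T.coordEquiv (T.lift g) (T.q_lift g)).module ℂ

/-- The element `[λ, γ]` of the fibre over `q γ = g`. -/
def fmk (c : ℂ) (γ : S) (h : T.q γ = g) : T.Fiber g := ⟨T.cls c γ, h⟩

/-- The coordinate of `a` with respect to `γ`: the number `λ` with `a = [λ, γ]`. -/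
def coord (γ : S) (h : T.q γ = g) (a : T.Fiber g) : ℂ := T.coordEquiv γ h a

theorem coord_fmk (c : ℂ) (γ : S) (h : T.q γ = g) : coord γ h (fmk c γ h) = c :=
  (T.coordEquiv γ h).apply_symm_apply c

theorem fmk_coord (γ : S) (h : T.q γ = g) (a : T.Fiber g) : fmk (coord γ h a) γ h = a :=
  (T.coordEquiv γ h).symm_apply_apply a

theorem cls_coord (γ : S) (h : T.q γ = g) (a : T.Fiber g) : T.cls (coord γ h a) γ = a.val :=
  congrArg Fiber.val (fmk_coord γ h a)

theorem coord_eq_iff {γ : S} {h : T.q γ = g} {a : T.Fiber g} {c : ℂ} :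
    coord γ h a = c ↔ a.val = T.cls c γ := by
  rw [← cls_coord γ h]
  exact (T.cls_injective γ).eq_iff.symm

theorem coord_act (z : Circle) (γ : S) (h : T.q (T.act z γ) = g) (h' : T.q γ = g)
    (a : T.Fiber g) : coord (T.act z γ) h a = starRingEnd ℂ (z : ℂ) * coord γ h' a := by
  rw [coord_eq_iff, cls_act, ← cls_coord γ h', ← mul_assoc, ← Circle.coe_inv_eq_conj,
    ← Circle.coe_mul]
  simp

theorem coord_lift_add (a b : T.Fiber g) : coord (T.lift g) (T.q_lift g) (a + b) =
    coord (T.lift g) (T.q_lift g) a + coord (T.lift g) (T.q_lift g) b :=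
  (T.coordEquiv (T.lift g) (T.q_lift g)).apply_symm_apply _

theorem coord_lift_smul (c : ℂ) (a : T.Fiber g) : coord (T.lift g) (T.q_lift g) (c • a) =
    c * coord (T.lift g) (T.q_lift g) a :=
  (T.coordEquiv (T.lift g) (T.q_lift g)).apply_symm_apply _

variable (T) in
/-- The coordinate with respect to `γ` as a linear isomorphism. -/
def coordLin (γ : S) (h : T.q γ = g) : T.Fiber g ≃ₗ[ℂ] ℂ :=
  { T.coordEquiv γ h with
    map_add' := fun a b => by
      obtain ⟨z, rfl⟩ := T.exists_act ((T.q_lift g).trans h.symm)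
      change coord _ _ _ = coord _ _ _ + coord _ _ _
      simp only [coord_act z (T.lift g) h (T.q_lift g), coord_lift_add, mul_add]
    map_smul' := fun c a => by
      obtain ⟨z, rfl⟩ := T.exists_act ((T.q_lift g).trans h.symm)
      change coord _ _ _ = c * coord _ _ _
      simp only [coord_act z (T.lift g) h (T.q_lift g), coord_lift_smul]
      ring }

theorem coordLin_apply (γ : S) (h : T.q γ = g) (a : T.Fiber g) :
    T.coordLin γ h a = coord γ h a := rfl

theorem coord_add (γ : S) (h : T.q γ = g) (a b : T.Fiber g) :
    coord γ h (a + b) = coord γ h a + coord γ h b := (T.coordLin γ h).map_add a b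

theorem coord_smul (γ : S) (h : T.q γ = g) (c : ℂ) (a : T.Fiber g) :
    coord γ h (c • a) = c * coord γ h a := (T.coordLin γ h).map_smul c a

theorem coord_zero (γ : S) (h : T.q γ = g) : coord γ h (0 : T.Fiber g) = 0 :=
  (T.coordLin γ h).map_zero

/-- The addition in the fibres is `[λ, γ] + [λ', γ'] = [λ + z λ', γ]`, where `γ' = z · γ`. -/
theorem fmk_add_fmk (c d : ℂ) (z : Circle) (γ : S) (h : T.q γ = g) (h' : T.q (T.act z γ) = g) :
    fmk c γ h + fmk d (T.act z γ) h' = fmk (c + z * d) γ h := by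
  have : fmk d (T.act z γ) h' = fmk (z * d) γ h := Fiber.ext (T.cls_act d z γ)
  rw [this, ← fmk_coord γ h (_ + _), coord_add, coord_fmk, coord_fmk]

theorem smul_fmk (c d : ℂ) (γ : S) (h : T.q γ = g) : c • fmk d γ h = fmk (c * d) γ h := by
  rw [← fmk_coord γ h (_ • _), coord_smul, coord_fmk]

/-- The norm on the fibres is `ϖ`; by `coordIso` below it gives each fibre the topology of `ℂ` under
`λ ↦ [λ, γ]`. -/
instance : Norm (T.Fiber g) := ⟨fun a => T.absL a.val⟩

theorem norm_def (a : T.Fiber g) : ‖a‖ = T.absL a.val := rfl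

theorem norm_eq (γ : S) (h : T.q γ = g) (a : T.Fiber g) : ‖a‖ = ‖coord γ h a‖ := by
  rw [norm_def, ← cls_coord γ h, absL_cls]

instance : NormedAddCommGroup (T.Fiber g) := NormedAddCommGroup.ofCore (𝕜 := ℂ)
  { norm_nonneg := fun a => by rw [norm_eq _ (T.q_lift g)]; exact norm_nonneg _
    norm_smul := fun c a => by
      rw [norm_eq _ (T.q_lift g), norm_eq _ (T.q_lift g) a, coord_smul, norm_mul]
    norm_triangle := fun a b => by
      simp only [norm_eq _ (T.q_lift g), coord_add]
      exact norm_add_le _ _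
    norm_eq_zero_iff := fun a => by
      rw [norm_eq _ (T.q_lift g), norm_eq_zero]
      exact (T.coordLin _ _).map_eq_zero_iff }

instance : NormedSpace ℂ (T.Fiber g) where
  norm_smul_le c a := by
    rw [norm_eq _ (T.q_lift g), norm_eq _ (T.q_lift g) a, coord_smul, norm_mul]

/-- The inner product on the fibres: `b̄ a = ⟪b, a⟫ · [1, s(g)]`, see `conj_mul_val`. -/
instance : InnerProductSpace ℂ (T.Fiber g) where
  inner a b := starRingEnd ℂ (coord (T.lift g) (T.q_lift g) a) * coord (T.lift g) (T.q_lift g) b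
  norm_sq_eq_re_inner a := by
    rw [norm_eq _ (T.q_lift g), ← Complex.normSq_eq_conj_mul_self, Complex.normSq_eq_norm_sq]
    exact (Complex.ofReal_re _).symm
  conj_inner_symm a b := by simp [mul_comm]
  add_left a b c := by simp [coord_add, add_mul]
  smul_left a b c := by simp [coord_smul, mul_assoc]

theorem inner_eq (γ : S) (h : T.q γ = g) (a b : T.Fiber g) :
    inner ℂ a b = starRingEnd ℂ (coord γ h a) * coord γ h b := by
  obtain ⟨z, rfl⟩ := T.exists_act ((T.q_lift g).trans h.symm)
  change starRingEnd ℂ (coord (T.lift g) (T.q_lift g) a) * coord (T.lift g) (T.q_lift g) b = _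
  rw [coord_act z _ _ (T.q_lift g), coord_act z _ _ (T.q_lift g)]
  have : (starRingEnd ℂ (z : ℂ)) * z = 1 := by
    rw [← Circle.coe_inv_eq_conj, ← Circle.coe_mul]; simp
  simp only [map_mul, Complex.conj_conj]
  linear_combination (-(starRingEnd ℂ) (coord (T.lift g) (T.q_lift g) a) *
    coord (T.lift g) (T.q_lift g) b) * this

/-- The product of fibre elements over composable arrows `g`, `h` with `g h = k`. -/
def Fiber.mul {g h k : G} (a : T.Fiber g) (b : T.Fiber h) (hc : src g = rng h)
    (hk : mul g h = k) : T.Fiber k :=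
  ⟨T.mulL a.val b.val, by
    rw [← cls_coord _ (T.q_lift g) a, ← cls_coord _ (T.q_lift h) b]
    have : src (T.lift g) = rng (T.lift h) := by
      rw [T.composable_iff, q_lift, q_lift, hc]
    rw [mulL_cls _ _ _ this, proj_cls, T.hom_q.map_mul _ _ this, q_lift, q_lift, hk]⟩

/-- The involution as a map from the fibre over `g` to the fibre over `h = g⁻¹`. -/
def Fiber.conj {g h : G} (a : T.Fiber g) (hh : inv g = h) : T.Fiber h :=
  ⟨T.conjL a.val, by
    rw [← cls_coord _ (T.q_lift g) a, conjL_cls, proj_cls, q_inv, q_lift, hh]⟩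

theorem coord_mul {g h k : G} (a : T.Fiber g) (b : T.Fiber h) (hc : src g = rng h)
    (hk : mul g h = k) (γ η ω : S) (hγ : T.q γ = g) (hη : T.q η = h) (hω : T.q ω = k)
    (hs : src γ = rng η) (hm : mul γ η = ω) :
    coord ω hω (a.mul b hc hk) = coord γ hγ a * coord η hη b := by
  rw [coord_eq_iff, ← hm, ← mulL_cls _ _ _ hs, cls_coord, cls_coord]
  rfl

theorem coord_conj {g h : G} (a : T.Fiber g) (hh : inv g = h) (γ η : S) (hγ : T.q γ = g)
    (hη : T.q η = h) (hi : inv γ = η) :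
    coord η hη (a.conj hh) = starRingEnd ℂ (coord γ hγ a) := by
  rw [coord_eq_iff, ← hi, ← conjL_cls, cls_coord]
  rfl

/-- `b̄ a = ⟪b, a⟫ · [1, s(g)]` for `a`, `b` in the fibre over `g`. -/
theorem conj_mul_val (a b : T.Fiber g) :
    T.mulL (T.conjL b.val) a.val = T.cls (inner ℂ b a) (T.ι (1, srcU g)) := by
  have h := T.q_lift g
  rw [← cls_coord _ h a, ← cls_coord _ h b, conjL_cls, mulL_cls T _ _ (src_inv _),
    inv_mul_self, inner_eq _ h, ← T.ι_src, h]

end FiberStructure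

section Sections

theorem continuous_cls : Continuous fun a : ℂ × S => T.cls a.1 a.2 := continuous_quotient_mk'

theorem continuous_proj : Continuous T.proj :=
  Continuous.quotient_lift (T.continuous_q.comp continuous_snd) _

/-- Local triviality, in the form in which it is used below. -/
theorem exists_local (g : G) : ∃ U : Set G, IsOpen U ∧ g ∈ U ∧ IsOpenBisection U ∧
    ∃ (φ : G → S) (ζ : S → Circle), ContinuousOn φ U ∧ (∀ h ∈ U, T.q (φ h) = h) ∧
      ContinuousOn ζ (T.q ⁻¹' U) ∧ ∀ γ ∈ T.q ⁻¹' U, T.act (ζ γ) (φ (T.q γ)) = γ := by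
  classical
  obtain ⟨U, hU, hg, φ, hφ, hq, he, hr⟩ := T.locallyTrivial g
  set e := fun p : Circle × U => mul (T.ι (p.1, rngU (p.2 : G))) (φ p.2) with he'
  have hact : ∀ p, e p = T.act p.1 (φ p.2) := fun p => by
    simp only [he', act, hq]
  refine ⟨U, hU.1, hg, hU, fun h => if hh : h ∈ U then φ ⟨h, hh⟩ else φ ⟨g, hg⟩,
    fun γ => if hh : γ ∈ Set.range e then (he.toHomeomorph.symm ⟨γ, hh⟩).1 else 1, ?_, ?_, ?_, ?_⟩
  · rw [continuousOn_iff_continuous_domRestrict]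
    convert hφ using 1
    ext h
    simp
  · intro h hh
    simp [hh, hq]
  · rw [← hr, continuousOn_iff_continuous_domRestrict]
    convert continuous_fst.comp he.toHomeomorph.symm.continuous using 1
    ext γ
    exact congrArg Subtype.val (dif_pos γ.2)
  · intro γ hγ
    have hγ' : T.q γ ∈ U := hγ
    rw [← hr] at hγ
    simp only [hγ, dif_pos, hγ']
    obtain ⟨p, rfl⟩ := hγ
    have : he.toHomeomorph.symm ⟨e p, ⟨p, rfl⟩⟩ = p :=
      he.toHomeomorph.symm_apply_apply p
    rw [this]
    have h2 : T.q (e p) = p.2 := by rw [hact, q_act, hq]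
    have h3 : (⟨T.q (e p), hγ'⟩ : U) = p.2 := Subtype.ext h2
    rw [h3, ← hact]

/-- All sections of the line bundle, a complex vector space under pointwise operations. -/
abbrev Sec : Type _ := ∀ g : G, T.Fiber g

variable {T}

/-- A section is continuous if it is so as a map from `G` to `L`. -/
def IsContSec (f : T.Sec) : Prop := Continuous fun g => (f g).val

/-- The covariant function on `S` that corresponds to a section. -/
def fn (f : T.Sec) (γ : S) : ℂ := coord γ rfl (f (T.q γ))

theorem coord_eq_fn (f : T.Sec) {g : G} (γ : S) (h : T.q γ = g) : coord γ h (f g) = fn f γ := by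
  subst h; rfl

theorem fn_act (f : T.Sec) (z : Circle) (γ : S) :
    fn f (T.act z γ) = starRingEnd ℂ (z : ℂ) * fn f γ := by
  rw [← coord_eq_fn f γ rfl, ← coord_eq_fn f _ (T.q_act z γ), coord_act]

theorem norm_eq_fn (f : T.Sec) {g : G} (γ : S) (h : T.q γ = g) : ‖f g‖ = ‖fn f γ‖ := by
  rw [norm_eq γ h, coord_eq_fn]

theorem isContSec_iff {f : T.Sec} : IsContSec f ↔ Continuous (fn f) := by
  classical
  constructor
  · intro hf
    rw [continuous_iff_continuousAt]
    intro γ₀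
    obtain ⟨U, hU, hg, -, φ, ζ, hφ, hq, hζ, hact⟩ := T.exists_local (T.q γ₀)
    have hU' : T.q ⁻¹' U ∈ 𝓝 γ₀ := (hU.preimage T.continuous_q).mem_nhds hg
    let Θ : T.LineBundle → ℂ := fun l =>
      if h : T.proj l ∈ U then coord (φ (T.proj l)) (hq _ h) ⟨l, rfl⟩ else 0
    have hΘ : ContinuousOn Θ (T.proj ⁻¹' U) := by
      have hquot : IsQuotientMap (fun a : ℂ × S => T.cls a.1 a.2) := isQuotientMap_quotient_mk'
      rw [hquot.continuousOn_isOpen_iff (hU.preimage T.continuous_proj)]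
      have hc : ContinuousOn (fun a : ℂ × S => (ζ a.2 : ℂ) * a.1)
          ((fun a : ℂ × S => T.cls a.1 a.2) ⁻¹' (T.proj ⁻¹' U)) := by
        refine ContinuousOn.mul ?_ continuousOn_fst
        exact continuous_subtype_val.comp_continuousOn
          (hζ.comp continuousOn_snd fun a ha => ha)
      refine hc.congr ?_
      rintro ⟨c, γ⟩ hγ
      have hγ' : T.q γ ∈ U := hγ
      refine (dif_pos hγ').trans ?_
      rw [coord_eq_iff]
      rw [← cls_act]
      change T.cls c γ = T.cls c (T.act (ζ γ) (φ (T.q γ)))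
      rw [hact γ hγ']
    have hmain : ContinuousOn (fun γ => starRingEnd ℂ (ζ γ : ℂ) * Θ (f (T.q γ)).val)
        (T.q ⁻¹' U) := by
      refine ContinuousOn.mul ?_ ?_
      · exact Complex.continuous_conj.comp_continuousOn
          (continuous_subtype_val.comp_continuousOn hζ)
      · refine hΘ.comp (hf.comp T.continuous_q).continuousOn ?_
        intro γ hγ
        change T.proj _ ∈ U
        rw [(f _).proj_val]
        exact hγ
    refine (hmain.continuousAt hU').congr ?_
    filter_upwards [hU'] with γ hγ
    have hγ' : T.q γ ∈ U := hγ
    have h1 : T.proj (f (T.q γ)).val = T.q γ := (f _).proj_val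
    have h2 : Θ (f (T.q γ)).val = fn f (φ (T.q γ)) := by
      simp only [Θ, h1, hγ', dif_pos]
      rw [coord_eq_iff]
      change (f (T.q γ)).val = _
      rw [← coord_eq_fn f _ (hq _ hγ'), cls_coord]
    rw [h2, ← fn_act, hact γ hγ']
  · intro hf
    unfold IsContSec
    rw [continuous_iff_continuousAt]
    intro g
    obtain ⟨U, hU, hg, -, φ, ζ, hφ, hq, -, -⟩ := T.exists_local g
    have h1 : ContinuousOn (fun h => T.cls (fn f (φ h)) (φ h)) U :=
      T.continuous_cls.comp_continuousOn
        ((hf.comp_continuousOn hφ).prodMk hφ)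
    refine (h1.continuousAt (hU.mem_nhds hg)).congr ?_
    filter_upwards [hU.mem_nhds hg] with h hh
    rw [← coord_eq_fn f _ (hq h hh), cls_coord]

theorem IsContSec.continuous_norm {f : T.Sec} (hf : IsContSec f) : Continuous fun g => ‖f g‖ := by
  rw [isContSec_iff] at hf
  rw [continuous_iff_continuousAt]
  intro g
  obtain ⟨U, hU, hg, -, φ, ζ, hφ, hq, -, -⟩ := T.exists_local g
  refine (((hf.comp_continuousOn hφ).norm).continuousAt (hU.mem_nhds hg)).congr ?_
  filter_upwards [hU.mem_nhds hg] with h hh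
  exact (norm_eq_fn f _ (hq h hh)).symm

theorem IsContSec.zero : IsContSec (0 : T.Sec) := by
  rw [isContSec_iff]
  convert continuous_const (y := (0 : ℂ)) using 1
  ext γ
  exact coord_zero _ _

theorem IsContSec.add {f g : T.Sec} (hf : IsContSec f) (hg : IsContSec g) :
    IsContSec (f + g) := by
  rw [isContSec_iff] at *
  convert hf.add hg using 1
  ext γ
  exact coord_add _ _ _ _

theorem IsContSec.smul {f : T.Sec} (c : ℂ) (hf : IsContSec f) : IsContSec (c • f) := by
  rw [isContSec_iff] at *
  convert hf.const_smul c using 1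
  ext γ
  exact coord_smul _ _ _ _

variable (T)

/-- `C_c(S; G)`: continuous sections `f` such that `ϖ ∘ f` has compact support. -/
def Cc : Submodule ℂ T.Sec where
  carrier := {f | IsContSec f ∧ HasCompactSupport fun g => ‖f g‖}
  zero_mem' := ⟨IsContSec.zero, by
    convert HasCompactSupport.zero (α := G) (β := ℝ) using 1
    ext g; simp⟩
  add_mem' := fun {f g} hf hg => ⟨hf.1.add hg.1,
    (hf.2.add hg.2).mono fun a ha => by
      contrapose! ha
      have h0 : ‖f a‖ + ‖g a‖ = 0 := by simpa using ha
      have := norm_add_le (f a) (g a)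
      have h2 := norm_nonneg ((f + g) a)
      simp only [Function.mem_support, not_not]
      exact le_antisymm (h0 ▸ this) h2⟩
  smul_mem' := fun c f hf => ⟨hf.1.smul c, hf.2.mono fun a ha => by
    contrapose! ha
    simp only [Function.mem_support, not_not, norm_eq_zero] at ha ⊢
    simp [ha]⟩

/-- `C_0(S; G)`: continuous sections `f` such that `ϖ ∘ f` vanishes at infinity. -/
def C0 : Submodule ℂ T.Sec where
  carrier := {f | IsContSec f ∧ Tendsto (fun g => ‖f g‖) (cocompact G) (𝓝 0)}
  zero_mem' := ⟨IsContSec.zero, by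
    simp only [Pi.zero_apply, norm_zero]; exact tendsto_const_nhds⟩
  add_mem' := fun {f g} hf hg => ⟨hf.1.add hg.1,
    squeeze_zero (fun _ => norm_nonneg _) (fun _ => norm_add_le _ _)
      (by simpa using hf.2.add hg.2)⟩
  smul_mem' := fun c f hf => ⟨hf.1.smul c, by
    simpa [norm_smul] using hf.2.const_mul ‖c‖⟩

theorem Cc_le_C0 : T.Cc ≤ T.C0 := fun _ hf =>
  ⟨hf.1, hf.2.is_zero_at_infty⟩

/-- The inclusion `C_c(S; G) → C_0(S; G)`. -/
def inclusionCc : T.Cc →ₗ[ℂ] T.C0 := Submodule.inclusion T.Cc_le_C0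

variable {T}

theorem C0_bddAbove (f : T.C0) : BddAbove (Set.range fun g => ‖(f : T.Sec) g‖) := by
  obtain ⟨C, hC⟩ := (ZeroAtInftyContinuousMap.isBounded_range
    (⟨⟨fun g => ‖(f : T.Sec) g‖, f.2.1.continuous_norm⟩, f.2.2⟩ :
      ZeroAtInftyContinuousMap G ℝ)).bddAbove
  exact ⟨C, hC⟩

/-- The norm `‖f‖ = sup_g ϖ(f(g))` on `C_0(S; G)`. -/
instance : Norm T.C0 := ⟨fun f => ⨆ g, ‖(f : T.Sec) g‖⟩

theorem C0_norm_def (f : T.C0) : ‖f‖ = ⨆ g, ‖(f : T.Sec) g‖ := rfl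

theorem C0_norm_apply_le (f : T.C0) (g : G) : ‖(f : T.Sec) g‖ ≤ ‖f‖ := le_ciSup (C0_bddAbove f) g

theorem C0_norm_le {f : T.C0} {c : ℝ} (hc : 0 ≤ c) (h : ∀ g, ‖(f : T.Sec) g‖ ≤ c) : ‖f‖ ≤ c :=
  Real.iSup_le h hc

theorem C0_norm_nonneg (f : T.C0) : 0 ≤ ‖f‖ := Real.iSup_nonneg fun _ => norm_nonneg _

instance : NormedAddCommGroup T.C0 := NormedAddCommGroup.ofCore (𝕜 := ℂ)
  { norm_nonneg := C0_norm_nonneg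
    norm_smul := fun c f => by
      simp only [C0_norm_def, Real.mul_iSup_of_nonneg (norm_nonneg c)]
      exact iSup_congr fun g => norm_smul c _
    norm_triangle := fun a b => C0_norm_le (add_nonneg (C0_norm_nonneg a) (C0_norm_nonneg b)) fun g =>
      (norm_add_le _ _).trans (add_le_add (C0_norm_apply_le a g) (C0_norm_apply_le b g))
    norm_eq_zero_iff := fun a => by
      refine ⟨fun h => Subtype.ext (funext fun g => ?_), fun h => by simp [h, C0_norm_def]⟩
      exact norm_le_zero_iff.1 (h ▸ C0_norm_apply_le a g) }

instance : NormedSpace ℂ T.C0 where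
  norm_smul_le c f := C0_norm_le (mul_nonneg (norm_nonneg _) (C0_norm_nonneg f)) fun g =>
    (norm_smul_le c _).trans (mul_le_mul_of_nonneg_left (C0_norm_apply_le f g) (norm_nonneg _))

end Sections

section Topology

theorem continuous_rng {H : Type*} [TopologicalSpace H] [TopGpd H] : Continuous (rng : H → H) := by
  have h : Continuous fun g : H => mul g (inv g) :=
    TopGpd.continuousOn_mul.comp_continuous (continuous_id.prodMk TopGpd.continuous_inv)
      fun g => (rng_inv g).symm
  simpa only [mul_inv_self] using h

theorem continuous_src {H : Type*} [TopologicalSpace H] [TopGpd H] : Continuous (src : H → H) := by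
  have h := (continuous_rng (H := H)).comp TopGpd.continuous_inv
  simpa only [Function.comp_def, rng_inv] using h

theorem continuous_rngU : Continuous (rngU : G → unitSpace G) := continuous_rng.subtype_mk _

theorem _root_.TwistedGroupoid.IsOpenBisection.exists_inverse {U : Set G} (hU : IsOpenBisection U) :
    (∀ W ⊆ U, IsOpen W → IsOpen (rngU '' W)) ∧
      ∃ β : unitSpace G → G, ContinuousOn β (rngU '' U) ∧ ∀ g ∈ U, β (rngU g) = g := by
  classical
  have he := hU.2.2
  constructor
  · intro W hW hWo
    have : rngU '' W = (fun b : U => rngU (b : G)) '' (Subtype.val ⁻¹' W) := by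
      ext x
      constructor
      · rintro ⟨g, hg, rfl⟩; exact ⟨⟨g, hW hg⟩, hg, rfl⟩
      · rintro ⟨g, hg, rfl⟩; exact ⟨g, hg, rfl⟩
    rw [this]
    exact he.isOpenMap _ (hWo.preimage continuous_subtype_val)
  · rcases U.eq_empty_or_nonempty with rfl | ⟨g₀, hg₀⟩
    · exact ⟨fun x => x, by simp, by simp⟩
    have hr : rngU '' U = Set.range fun b : U => rngU (b : G) := Set.image_eq_range _ _
    refine ⟨fun x => if h : x ∈ Set.range fun b : U => rngU (b : G) then
      (he.isEmbedding.toHomeomorph.symm ⟨x, h⟩ : U) else g₀, ?_, ?_⟩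
    · rw [hr, continuousOn_iff_continuous_domRestrict]
      convert continuous_subtype_val.comp he.isEmbedding.toHomeomorph.symm.continuous using 1
      ext x
      exact dif_pos x.2
    · intro g hg
      have h : rngU g ∈ Set.range fun b : U => rngU (b : G) := ⟨⟨g, hg⟩, rfl⟩
      refine (dif_pos h).trans ?_
      exact congrArg Subtype.val (he.isEmbedding.toHomeomorph.symm_apply_apply ⟨g, hg⟩)

theorem _root_.TwistedGroupoid.IsOpenBisection.src_inj {U : Set G} (hU : IsOpenBisection U)
    {g h : G} (hg : g ∈ U) (hh : h ∈ U) (e : src g = src h) : g = h :=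
  congrArg Subtype.val (hU.2.1.injective (a₁ := ⟨g, hg⟩) (a₂ := ⟨h, hh⟩) (Subtype.ext e))

theorem _root_.TwistedGroupoid.IsOpenBisection.rng_inj {U : Set G} (hU : IsOpenBisection U)
    {g h : G} (hg : g ∈ U) (hh : h ∈ U) (e : rng g = rng h) : g = h :=
  congrArg Subtype.val (hU.2.2.injective (a₁ := ⟨g, hg⟩) (a₂ := ⟨h, hh⟩) (Subtype.ext e))

/-- A compact set meets the fibres of `s` and `r` in a bounded number of points. -/
theorem exists_fiber_bound {K : Set G} (hK : IsCompact K) : ∃ n : ℕ,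
    (∀ x, ∃ F : Finset G, F.card ≤ n ∧ ∀ g ∈ K, src g = x → g ∈ F) ∧
      ∀ x, ∃ F : Finset G, F.card ≤ n ∧ ∀ g ∈ K, rng g = x → g ∈ F := by
  classical
  have hb : ∀ g : G, ∃ U : Set G, IsOpenBisection U ∧ g ∈ U := fun g => by
    obtain ⟨U, hU, hg, -⟩ := EtaleGpd.isTopologicalBasis_bisections.exists_subset_of_mem_open
      (Set.mem_univ g) isOpen_univ
    exact ⟨U, hU, hg⟩
  choose U hU hgU using hb
  obtain ⟨t, -, ht⟩ := hK.elim_nhds_subcover U fun g _ => (hU g).1.mem_nhds (hgU g)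
  have key : ∀ (m : G → G), (∀ i, ∀ g ∈ U i, ∀ h ∈ U i, m g = m h → g = h) →
      ∀ x, ∃ F : Finset G, F.card ≤ t.card ∧ ∀ g ∈ K, m g = x → g ∈ F := by
    intro m hm x
    refine ⟨t.image fun i => if h : ∃ g ∈ U i, m g = x then h.choose else i,
      Finset.card_image_le, fun g hg hx => ?_⟩
    obtain ⟨i, hi, hgi⟩ := Set.mem_iUnion₂.1 (ht hg)
    refine Finset.mem_image.2 ⟨i, hi, ?_⟩
    have h : ∃ g ∈ U i, m g = x := ⟨g, hgi, hx⟩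
    rw [dif_pos h]
    exact hm i _ h.choose_spec.1 _ hgi (h.choose_spec.2.trans hx.symm)
  exact ⟨t.card, key src fun i g hg h hh => (hU i).src_inj hg hh,
    key rng fun i g hg h hh => (hU i).rng_inj hg hh⟩

theorem exists_section_bound {f : T.Sec} (hf : f ∈ T.Cc) : ∃ (n : ℕ) (M : ℝ), 0 ≤ M ∧
    (∀ g, ‖f g‖ ≤ M) ∧
    (∀ x, ∃ F : Finset G, F.card ≤ n ∧ ∀ g, f g ≠ 0 → src g = x → g ∈ F) ∧
      ∀ x, ∃ F : Finset G, F.card ≤ n ∧ ∀ g, f g ≠ 0 → rng g = x → g ∈ F := by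
  obtain ⟨n, h1, h2⟩ := exists_fiber_bound hf.2
  have hK : ∀ g, f g ≠ 0 → g ∈ tsupport fun g => ‖f g‖ := fun g hg =>
    subset_tsupport _ (by simpa using hg)
  refine ⟨n, ‖(⟨f, T.Cc_le_C0 hf⟩ : T.C0)‖, C0_norm_nonneg _,
    C0_norm_apply_le (⟨f, T.Cc_le_C0 hf⟩ : T.C0), fun x => ?_, fun x => ?_⟩
  · obtain ⟨F, hF, h⟩ := h1 x
    exact ⟨F, hF, fun g hg hx => h g (hK g hg) hx⟩
  · obtain ⟨F, hF, h⟩ := h2 x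
    exact ⟨F, hF, fun g hg hx => h g (hK g hg) hx⟩

end Topology

section FiberProduct

variable {T}

theorem composable_lift {g h : G} (hc : src g = rng h) : src (T.lift g) = rng (T.lift h) := by
  rw [T.composable_iff, q_lift, q_lift, hc]

theorem fiber_coord_mul_lift {g h k : G} (hc : src g = rng h)
    (hk : Gpd.mul g h = k) : ∃ (ω : S) (hω : T.q ω = k), ∀ (a : T.Fiber g) (b : T.Fiber h),
      coord ω hω (a.mul b hc hk) =
        coord (T.lift g) (T.q_lift g) a * coord (T.lift h) (T.q_lift h) b := by
  refine ⟨mul (T.lift g) (T.lift h), ?_, fun a b => ?_⟩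
  · rw [T.hom_q.map_mul _ _ (composable_lift hc), q_lift, q_lift, hk]
  · exact coord_mul _ _ _ _ _ _ _ _ _ _ (composable_lift hc) rfl

theorem coord_injective {g : G} (γ : S) (h : T.q γ = g) :
    Function.Injective (coord γ h : T.Fiber g → ℂ) := (T.coordEquiv γ h).injective

theorem fiber_norm_mul {g h k : G} (a : T.Fiber g) (b : T.Fiber h) (hc : src g = rng h)
    (hk : mul g h = k) : ‖a.mul b hc hk‖ = ‖a‖ * ‖b‖ := by
  obtain ⟨ω, hω, H⟩ := fiber_coord_mul_lift (T := T) hc hk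
  rw [norm_eq ω hω, H, norm_mul, ← norm_eq, ← norm_eq]

theorem fiber_mul_add {g h k : G} (a : T.Fiber g) (b c : T.Fiber h) (hc : src g = rng h)
    (hk : mul g h = k) : a.mul (b + c) hc hk = a.mul b hc hk + a.mul c hc hk := by
  obtain ⟨ω, hω, H⟩ := fiber_coord_mul_lift (T := T) hc hk
  apply coord_injective ω hω
  simp only [coord_add, H]; ring

theorem fiber_add_mul {g h k : G} (a b : T.Fiber g) (c : T.Fiber h) (hc : src g = rng h)
    (hk : mul g h = k) : (a + b).mul c hc hk = a.mul c hc hk + b.mul c hc hk := by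
  obtain ⟨ω, hω, H⟩ := fiber_coord_mul_lift (T := T) hc hk
  apply coord_injective ω hω
  simp only [coord_add, H]; ring

theorem fiber_mul_smul {g h k : G} (t : ℂ) (a : T.Fiber g) (b : T.Fiber h) (hc : src g = rng h)
    (hk : mul g h = k) : a.mul (t • b) hc hk = t • a.mul b hc hk := by
  obtain ⟨ω, hω, H⟩ := fiber_coord_mul_lift (T := T) hc hk
  apply coord_injective ω hω
  simp only [coord_smul, H]; ring

theorem fiber_smul_mul {g h k : G} (t : ℂ) (a : T.Fiber g) (b : T.Fiber h) (hc : src g = rng h)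
    (hk : mul g h = k) : (t • a).mul b hc hk = t • a.mul b hc hk := by
  obtain ⟨ω, hω, H⟩ := fiber_coord_mul_lift (T := T) hc hk
  apply coord_injective ω hω
  simp only [coord_smul, H]; ring

theorem fiber_zero_mul {g h k : G} (b : T.Fiber h) (hc : src g = rng h)
    (hk : mul g h = k) : (0 : T.Fiber g).mul b hc hk = 0 := by
  rw [← norm_eq_zero, fiber_norm_mul, norm_zero, MulZeroClass.zero_mul]

theorem fiber_mul_zero {g h k : G} (a : T.Fiber g) (hc : src g = rng h)
    (hk : mul g h = k) : a.mul (0 : T.Fiber h) hc hk = 0 := by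
  rw [← norm_eq_zero, fiber_norm_mul, norm_zero, MulZeroClass.mul_zero]

variable (T) in
/-- The coordinate with respect to `γ` as a linear isometry. -/
def coordIso {g : G} (γ : S) (h : T.q γ = g) : T.Fiber g ≃ₗᵢ[ℂ] ℂ :=
  ⟨T.coordLin γ h, fun a => (norm_eq γ h a).symm⟩

instance {g : G} : CompleteSpace (T.Fiber g) :=
  ((T.coordIso (T.lift g) (T.q_lift g)).isometry.isUniformInducing.completeSpace_congr
    (T.coordIso (T.lift g) (T.q_lift g)).surjective).2 inferInstance

theorem coord_tsum {g : G} (γ : S) (h : T.q γ = g) {I : Type*} (a : I → T.Fiber g) :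
    coord γ h (∑' i, a i) = ∑' i, coord γ h (a i) :=
  (T.coordIso γ h).toContinuousLinearEquiv.map_tsum

end FiberProduct

section RegularRepresentation

/-- The fibre `Gx = {γ ∈ G | s(γ) = x}`. -/
abbrev SrcFiber (x : unitSpace G) : Type _ := {γ : G // src γ = x}

/-- The Hilbert space of square summable sections of the line bundle over `Gx`. -/
abbrev Hilb (x : unitSpace G) : Type _ := lp (fun γ : SrcFiber x => T.Fiber (γ : G)) 2

/-- The product `γ ζ⁻¹` for `γ`, `ζ` in `Gx`. -/
def quo {x : unitSpace G} (γ ζ : SrcFiber x) : G := mul (γ : G) (inv (ζ : G))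

theorem quo_aux {x : unitSpace G} (γ ζ : SrcFiber x) : src (γ : G) = rng (inv (ζ : G)) := by
  rw [rng_inv, γ.2, ζ.2]

theorem src_quo {x : unitSpace G} (γ ζ : SrcFiber x) : src (quo γ ζ) = rng (ζ : G) := by
  rw [quo, src_mul _ _ (quo_aux γ ζ), src_inv]

theorem rng_quo {x : unitSpace G} (γ ζ : SrcFiber x) : rng (quo γ ζ) = rng (γ : G) :=
  rng_mul _ _ (quo_aux γ ζ)

theorem quo_mul {x : unitSpace G} (γ ζ : SrcFiber x) : mul (quo γ ζ) (ζ : G) = γ :=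
  inv_mul_cancel_right (γ.2.trans ζ.2.symm)

theorem quo_left_injective {x : unitSpace G} (ζ : SrcFiber x) :
    Function.Injective fun γ : SrcFiber x => quo γ ζ := fun γ γ' h => by
  apply Subtype.ext
  rw [← quo_mul γ ζ, ← quo_mul γ' ζ]
  exact congrArg (fun t => mul t (ζ : G)) h

theorem quo_right_injective {x : unitSpace G} (γ : SrcFiber x) :
    Function.Injective fun ζ : SrcFiber x => quo γ ζ := fun ζ ζ' h => by
  apply Subtype.ext
  have h1 : inv (ζ : G) = inv (ζ' : G) := by
    rw [← inv_mul_cancel_left (quo_aux γ ζ), ← inv_mul_cancel_left (quo_aux γ ζ')]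
    exact congrArg (fun t => mul (inv (γ : G)) t) h
  rw [← inv_inv (ζ : G), h1, inv_inv]

variable {T}

/-- The summand `f(γ ζ⁻¹) χ(ζ)`, an element of the fibre over `γ`. -/
def piTerm (f : T.Sec) {x : unitSpace G} (γ ζ : SrcFiber x) (a : T.Fiber (ζ : G)) :
    T.Fiber (γ : G) :=
  (f (quo γ ζ)).mul a (src_quo γ ζ) (quo_mul γ ζ)

/-- `(π_x(f) χ)(γ) = ∑_{η ζ = γ} f(η) χ(ζ) = ∑_{ζ ∈ Gx} f(γ ζ⁻¹) χ(ζ)`. -/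
def piFun (f : T.Sec) {x : unitSpace G} (χ : ∀ ζ : SrcFiber x, T.Fiber (ζ : G))
    (γ : SrcFiber x) : T.Fiber (γ : G) := ∑' ζ, piTerm f γ ζ (χ ζ)

theorem exists_row_bound {f : T.Sec} (hf : f ∈ T.Cc) : ∃ (n : ℕ) (M : ℝ), 0 ≤ M ∧
    (∀ g, ‖f g‖ ≤ M) ∧ ∀ x : unitSpace G,
    (∀ γ : SrcFiber x, ∃ F : Finset (SrcFiber x), F.card ≤ n ∧ ∀ ζ ∉ F, f (quo γ ζ) = 0) ∧
    ∀ ζ : SrcFiber x, ∃ F : Finset (SrcFiber x), F.card ≤ n ∧ ∀ γ ∉ F, f (quo γ ζ) = 0 := by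
  classical
  obtain ⟨n, M, hM, hfM, h1, h2⟩ := T.exists_section_bound hf
  refine ⟨n, M, hM, hfM, fun x => ⟨fun γ => ?_, fun ζ => ?_⟩⟩
  · obtain ⟨F, hF, h⟩ := h2 (rng (γ : G))
    refine ⟨F.preimage _ (quo_right_injective γ).injOn, ?_, fun ζ hζ => ?_⟩
    · exact (Finset.card_le_card_of_injOn (fun ζ => quo γ ζ) (fun ζ hζ => by simpa using hζ)
        (quo_right_injective γ).injOn).trans hF
    · by_contra h0
      exact hζ (Finset.mem_preimage.2 (h _ h0 (rng_quo γ ζ)))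
  · obtain ⟨F, hF, h⟩ := h1 (rng (ζ : G))
    refine ⟨F.preimage _ (quo_left_injective ζ).injOn, ?_, fun γ hγ => ?_⟩
    · exact (Finset.card_le_card_of_injOn (fun γ => quo γ ζ) (fun γ hγ => by simpa using hγ)
        (quo_left_injective ζ).injOn).trans hF
    · by_contra h0
      exact hγ (Finset.mem_preimage.2 (h _ h0 (src_quo γ ζ)))

theorem summable_piTerm {f : T.Sec} (hf : f ∈ T.Cc) {x : unitSpace G}
    (χ : ∀ ζ : SrcFiber x, T.Fiber (ζ : G)) (γ : SrcFiber x) :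
    Summable fun ζ => piTerm f γ ζ (χ ζ) := by
  obtain ⟨n, M, -, -, h⟩ := exists_row_bound hf
  obtain ⟨F, -, hF⟩ := (h x).1 γ
  refine summable_of_ne_finset_zero (s := F) fun ζ hζ => ?_
  simp [piTerm, hF ζ hζ, fiber_zero_mul]

theorem exists_piFun_bound {f : T.Sec} (hf : f ∈ T.Cc) : ∃ C : ℝ, 0 ≤ C ∧
    ∀ (x : unitSpace G) (χ : T.Hilb x) (A : Finset (SrcFiber x)),
      ∑ γ ∈ A, ‖piFun f χ γ‖ ^ 2 ≤ (C * ‖χ‖) ^ 2 := by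
  classical
  obtain ⟨n, M, hM, hfM, h⟩ := exists_row_bound hf
  refine ⟨n * M, by positivity, fun x χ A => ?_⟩
  choose R hR hR0 using (h x).1
  choose C hC hC0 using (h x).2
  have h1 : ∀ γ, ‖piFun f χ γ‖ ^ 2 ≤ n * ∑ ζ ∈ R γ, (‖f (quo γ ζ)‖ * ‖χ ζ‖) ^ 2 := by
    intro γ
    have e : piFun f χ γ = ∑ ζ ∈ R γ, piTerm f γ ζ (χ ζ) :=
      tsum_eq_sum fun ζ hζ => by simp [piTerm, hR0 γ ζ hζ, fiber_zero_mul]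
    have e2 : ‖piFun f χ γ‖ ≤ ∑ ζ ∈ R γ, ‖f (quo γ ζ)‖ * ‖χ ζ‖ := by
      rw [e]
      exact (norm_sum_le _ _).trans (Finset.sum_le_sum fun ζ _ => (fiber_norm_mul _ _ _ _).le)
    calc ‖piFun f χ γ‖ ^ 2 ≤ (∑ ζ ∈ R γ, ‖f (quo γ ζ)‖ * ‖χ ζ‖) ^ 2 := by gcongr
      _ ≤ (R γ).card * ∑ ζ ∈ R γ, (‖f (quo γ ζ)‖ * ‖χ ζ‖) ^ 2 := sq_sum_le_card_mul_sum_sq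
      _ ≤ _ := by
        gcongr
        exact hR γ
  have h2 : ∀ ζ, ∑ γ ∈ A, ‖f (quo γ ζ)‖ ^ 2 ≤ n * M ^ 2 := by
    intro ζ
    calc ∑ γ ∈ A, ‖f (quo γ ζ)‖ ^ 2 ≤ ∑ γ ∈ A ∪ C ζ, ‖f (quo γ ζ)‖ ^ 2 :=
          Finset.sum_le_sum_of_subset_of_nonneg Finset.subset_union_left fun _ _ _ => by positivity
      _ = ∑ γ ∈ C ζ, ‖f (quo γ ζ)‖ ^ 2 :=
          (Finset.sum_subset Finset.subset_union_right fun γ _ hγ => by simp [hC0 ζ γ hγ]).symm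
      _ ≤ ∑ γ ∈ C ζ, M ^ 2 := by
          gcongr
          exact hfM _
      _ = (C ζ).card * M ^ 2 := by simp
      _ ≤ _ := by
        gcongr
        exact hC ζ
  have h3 : ∑ ζ ∈ A.biUnion R, ‖χ ζ‖ ^ 2 ≤ ‖χ‖ ^ 2 := by
    simpa using lp.sum_rpow_le_norm_rpow (by simp) χ (A.biUnion R)
  calc ∑ γ ∈ A, ‖piFun f χ γ‖ ^ 2
      ≤ ∑ γ ∈ A, n * ∑ ζ ∈ A.biUnion R, (‖f (quo γ ζ)‖ * ‖χ ζ‖) ^ 2 := by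
        refine Finset.sum_le_sum fun γ hγ => (h1 γ).trans ?_
        gcongr
        exact Finset.subset_biUnion_of_mem R hγ
    _ = n * ∑ ζ ∈ A.biUnion R, (∑ γ ∈ A, ‖f (quo γ ζ)‖ ^ 2) * ‖χ ζ‖ ^ 2 := by
        rw [← Finset.mul_sum, Finset.sum_comm]
        simp only [mul_pow, Finset.sum_mul]
    _ ≤ n * ∑ ζ ∈ A.biUnion R, (n * M ^ 2) * ‖χ ζ‖ ^ 2 := by
        gcongr with ζ
        exact h2 ζ
    _ = (n * M) ^ 2 * ∑ ζ ∈ A.biUnion R, ‖χ ζ‖ ^ 2 := by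
        rw [← Finset.mul_sum]; ring
    _ ≤ (n * M) ^ 2 * ‖χ‖ ^ 2 := by gcongr
    _ = _ := by ring

theorem memℓp_piFun {f : T.Sec} (hf : f ∈ T.Cc) {x : unitSpace G} (χ : T.Hilb x) :
    Memℓp (piFun f χ) 2 := by
  obtain ⟨C, -, h⟩ := exists_piFun_bound hf
  exact memℓp_gen' (C := (C * ‖χ‖) ^ 2) fun A => by simpa using h x χ A

theorem exists_norm_piFun_le {f : T.Sec} (hf : f ∈ T.Cc) : ∃ C : ℝ, 0 ≤ C ∧
    ∀ (x : unitSpace G) (χ : T.Hilb x), ‖(⟨piFun f χ, memℓp_piFun hf χ⟩ : T.Hilb x)‖ ≤ C * ‖χ‖ := by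
  obtain ⟨C, hC, h⟩ := exists_piFun_bound hf
  refine ⟨C, hC, fun x χ => ?_⟩
  exact lp.norm_le_of_forall_sum_le (by simp) (by positivity) fun A => by simpa using h x χ A

theorem piFun_add {f : T.Sec} (hf : f ∈ T.Cc) {x : unitSpace G}
    (χ ψ : ∀ ζ : SrcFiber x, T.Fiber (ζ : G)) : piFun f (χ + ψ) = piFun f χ + piFun f ψ := by
  ext1 γ
  refine Eq.trans ?_ ((summable_piTerm hf χ γ).tsum_add (summable_piTerm hf ψ γ))
  exact tsum_congr fun ζ => fiber_mul_add _ _ _ _ _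

theorem piFun_smul {f : T.Sec} (hf : f ∈ T.Cc) {x : unitSpace G} (c : ℂ)
    (χ : ∀ ζ : SrcFiber x, T.Fiber (ζ : G)) : piFun f (c • χ) = c • piFun f χ := by
  ext1 γ
  refine Eq.trans ?_ ((summable_piTerm hf χ γ).tsum_const_smul c)
  exact tsum_congr fun ζ => fiber_mul_smul _ _ _ _ _

/-- The operator `π_x(f)` as a linear map. -/
def piLin (x : unitSpace G) (f : T.Cc) : T.Hilb x →ₗ[ℂ] T.Hilb x where
  toFun χ := ⟨piFun (f : T.Sec) χ, memℓp_piFun f.2 χ⟩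
  map_add' χ ψ := Subtype.ext (piFun_add f.2 χ ψ)
  map_smul' c χ := Subtype.ext (piFun_smul f.2 c χ)

/-- The regular representation `π_x(f)` on `ℓ²`-sections over `Gx`. -/
def piRep (x : unitSpace G) (f : T.Cc) : T.Hilb x →L[ℂ] T.Hilb x :=
  (piLin x f).mkContinuousOfExistsBound (by
    obtain ⟨C, -, h⟩ := exists_norm_piFun_le f.2
    exact ⟨C, h x⟩)

theorem piRep_apply (x : unitSpace G) (f : T.Cc) (χ : T.Hilb x) (γ : SrcFiber x) :
    piRep x f χ γ = ∑' ζ, piTerm (f : T.Sec) γ ζ (χ ζ) := rfl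

theorem exists_norm_piRep_le (f : T.Cc) : ∃ C : ℝ, ∀ x, ‖piRep x f‖ ≤ C := by
  obtain ⟨C, hC, h⟩ := exists_norm_piFun_le f.2
  exact ⟨C, fun x => ContinuousLinearMap.opNorm_le_bound _ hC (h x)⟩

theorem piRep_single [DecidableEq G] (x : unitSpace G) (f : T.Cc) (ζ : SrcFiber x)
    (a : T.Fiber (ζ : G)) (γ : SrcFiber x) :
    piRep x f (lp.single 2 ζ a) γ = piTerm (f : T.Sec) γ ζ a := by
  rw [piRep_apply x f, tsum_eq_single ζ]
  · simp
  · intro ζ' h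
    simp [h, piTerm, fiber_mul_zero]

end RegularRepresentation

section Convolution

variable {T}

/-- The summand `f(η) g(η⁻¹ γ)` of the convolution, an element of the fibre over `γ`. -/
def convTerm (f g : T.Sec) (γ : G) (η : {η : G // rng η = rng γ}) : T.Fiber γ :=
  (f (η : G)).mul (g (mul (inv (η : G)) γ))
    (by rw [rng_mul _ _ ((src_inv _).trans η.2), rng_inv]) (mul_inv_cancel_left η.2)

/-- The convolution `(f * g)(γ) = ∑_{r(η) = r(γ)} f(η) g(η⁻¹ γ)`.  (For `f` in `C_c(S; G)` the sum
has only finitely many nonzero terms.) -/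
def conv (f g : T.Sec) : T.Sec := fun γ => ∑' η, convTerm f g γ η

/-- The involution `f^*(γ) = conj (f(γ⁻¹))`. -/
def invol (f : T.Sec) : T.Sec := fun γ => (f (inv γ)).conj (inv_inv γ)

theorem fn_invol (f : T.Sec) (γ : S) : fn (invol f) γ = starRingEnd ℂ (fn f (inv γ)) := by
  unfold fn invol
  rw [coord_conj _ _ (inv γ) γ (T.q_inv γ) rfl (inv_inv γ), coord_eq_fn]
  rfl

/-- The products occurring in the convolution, in terms of covariant functions; any representative
`ω` of `η` may be used. -/
theorem coord_conv_term (f g : T.Sec) {γ : S} {η k a : G} (ω : S) (hω : T.q ω = η)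
    (h1 : rng η = rng (T.q γ)) (ha : a = mul (inv η) (T.q γ)) (hc : src η = rng a)
    (hk : mul η a = k) (hb : T.q γ = k) :
    coord γ hb ((f η).mul (g a) hc hk) = fn f ω * fn g (mul (inv ω) γ) := by
  subst hω ha
  have hr : rng ω = rng γ := by rw [← T.ι_rng, ← T.ι_rng]; congr 2; exact Subtype.ext h1
  have hs : src (inv ω) = rng γ := (src_inv ω).trans hr
  have hq : T.q (mul (inv ω) γ) = mul (inv (T.q ω)) (T.q γ) := by
    rw [T.hom_q.map_mul _ _ hs, q_inv]
  rw [coord_mul _ _ _ _ ω (mul (inv ω) γ) γ rfl hq hb (by rw [rng_mul _ _ hs, rng_inv])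
    (mul_inv_cancel_left hr), coord_eq_fn, coord_eq_fn]

theorem fn_conv (f g : T.Sec) (γ : S) : fn (conv f g) γ =
    ∑' η : {η : G // rng η = rng (T.q γ)},
      fn f (T.lift (η : G)) * fn g (mul (inv (T.lift (η : G))) γ) := by
  unfold conv convTerm
  rw [fn, coord_tsum]
  exact tsum_congr fun η => coord_conv_term f g _ (T.q_lift _) η.2 rfl _ _ _

theorem norm_invol (f : T.Sec) (g : G) : ‖invol f g‖ = ‖f (inv g)‖ := by
  have h : T.q (inv (T.lift g)) = inv g := by rw [q_inv, q_lift]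
  rw [norm_eq_fn _ _ (T.q_lift g), norm_eq_fn _ _ h, fn_invol, RCLike.norm_conj]

/-- Inversion as a homeomorphism. -/
def invHomeo : G ≃ₜ G where
  toFun := inv
  invFun := inv
  left_inv := inv_inv
  right_inv := inv_inv
  continuous_toFun := TopGpd.continuous_inv
  continuous_invFun := TopGpd.continuous_inv

theorem invol_mem {f : T.Sec} (hf : f ∈ T.Cc) : invol f ∈ T.Cc := by
  constructor
  · have := isContSec_iff.1 hf.1
    rw [isContSec_iff]
    convert Complex.continuous_conj.comp (this.comp TopGpd.continuous_inv) using 1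
    ext γ
    exact fn_invol f γ
  · have := HasCompactSupport.comp_homeomorph hf.2 (invHomeo (G := G))
    simp only [norm_invol]
    exact this

theorem exists_of_conv_ne_zero {f g : T.Sec} {γ : G} (h : conv f g γ ≠ 0) :
    ∃ η, rng η = rng γ ∧ f η ≠ 0 ∧ g (mul (inv η) γ) ≠ 0 := by
  by_contra! H
  apply h
  unfold conv convTerm
  refine (tsum_congr fun η => ?_).trans tsum_zero
  by_cases h0 : f (η : G) = 0
  · rw [h0, fiber_zero_mul]
  · rw [H _ η.2 h0, fiber_mul_zero]

theorem continuous_fn_conv [T2Space G] {f g : T.Sec} (hf : f ∈ T.Cc) (hg : IsContSec g) :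
    Continuous (fn (conv f g)) := by
  classical
  set K := tsupport fun g => ‖f g‖ with hKdef
  have hK : IsCompact K := hf.2
  have hfK : ∀ η, η ∉ K → f η = 0 := fun η h => by
    have := image_eq_zero_of_notMem_tsupport h
    simpa using this
  have hfn0 : ∀ ω : S, f (T.q ω) = 0 → fn f ω = 0 := fun ω h => by
    unfold fn; rw [h, coord_zero]
  have hcf := isContSec_iff.1 hf.1
  have hcg := isContSec_iff.1 hg
  rw [continuous_iff_continuousAt]
  intro γ₀
  obtain ⟨n, -, hfin⟩ := exists_fiber_bound hK
  obtain ⟨F, -, hF⟩ := hfin (rng (T.q γ₀))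
  let A : Finset G := F.filter fun η => η ∈ K ∧ rng η = rng (T.q γ₀)
  obtain ⟨V, hV, hVd⟩ := A.finite_toSet.t2_separation
  choose U hUo hUm hUb φ ζ hφ hφq _ _ using T.exists_local
  choose hop β hβc hβ using fun η => (hUb η).exists_inverse
  let W : G → Set G := fun η => U η ∩ V η
  have hWo : ∀ η, IsOpen (W η) := fun η => (hUo η).inter (hV η).2
  have hWm : ∀ η, η ∈ W η := fun η => ⟨hUm η, (hV η).1⟩
  let p : S → unitSpace G := fun γ => rngU (T.q γ)
  have hp : Continuous p := continuous_rngU.comp T.continuous_q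
  let C : Set G := K \ ⋃ η ∈ A, W η
  have hC : IsCompact C := hK.diff (isOpen_biUnion fun η _ => hWo η)
  have hC' : IsClosed (rngU '' C) := (hC.image continuous_rngU).isClosed
  let N : Set S := p ⁻¹' ((rngU '' C)ᶜ ∩ ⋂ η ∈ A, rngU '' W η)
  have hN : IsOpen N := (hC'.isOpen_compl.inter
    (isOpen_biInter_finset fun η _ => hop η _ Set.inter_subset_left (hWo η))).preimage hp
  have hγN : γ₀ ∈ N := by
    refine ⟨?_, ?_⟩
    · rintro ⟨η, hη, hηp⟩
      have h1 : rng η = rng (T.q γ₀) := congrArg Subtype.val hηp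
      refine hη.2 (Set.mem_biUnion (x := η) ?_ (hWm η))
      exact Finset.mem_filter.2 ⟨hF η hη.1 h1, hη.1, h1⟩
    · refine Set.mem_iInter₂.2 fun η hη => ⟨η, hWm η, Subtype.ext ?_⟩
      exact (Finset.mem_filter.1 hη).2.2
  let τ : G → S → S := fun η γ => φ η (β η (p γ))
  have hin : ∀ η ∈ A, ∀ γ ∈ N, β η (p γ) ∈ W η ∧ rng (β η (p γ)) = rng (T.q γ) := by
    intro η hη γ hγ
    obtain ⟨a, ha, hap⟩ := Set.mem_iInter₂.1 hγ.2 η hη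
    rw [← hap, hβ η a ha.1]
    exact ⟨ha, congrArg Subtype.val hap⟩
  have hτq : ∀ η ∈ A, ∀ γ ∈ N, T.q (τ η γ) = β η (p γ) := fun η hη γ hγ =>
    hφq η _ (hin η hη γ hγ).1.1
  have hτr : ∀ η ∈ A, ∀ γ ∈ N, rng (τ η γ) = rng γ := fun η hη γ hγ => by
    rw [← T.ι_rng, ← T.ι_rng]
    congr 2
    exact Subtype.ext (by
      change rng _ = rng _
      rw [hτq η hη γ hγ, (hin η hη γ hγ).2])
  have hτc : ∀ η ∈ A, ContinuousOn (τ η) N := by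
    intro η hη
    refine (hφ η).comp ((hβc η).comp hp.continuousOn fun γ hγ => ?_) fun γ hγ =>
      (hin η hη γ hγ).1.1
    exact Set.image_mono Set.inter_subset_left (Set.mem_iInter₂.1 hγ.2 η hη)
  have hsum : ContinuousOn
      (fun γ => ∑ η ∈ A, fn f (τ η γ) * fn g (mul (inv (τ η γ)) γ)) N := by
    refine continuousOn_finsetSum _ fun η hη => ?_
    refine (hcf.comp_continuousOn (hτc η hη)).mul (hcg.comp_continuousOn ?_)
    refine TopGpd.continuousOn_mul.comp
      ((TopGpd.continuous_inv.comp_continuousOn (hτc η hη)).prodMk continuousOn_id) ?_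
    intro γ hγ
    change src (inv _) = rng γ
    rw [src_inv, hτr η hη γ hγ]
  refine (hsum.continuousAt (hN.mem_nhds hγN)).congr ?_
  filter_upwards [hN.mem_nhds hγN] with γ hγ
  rw [fn, conv, coord_tsum]
  unfold convTerm
  let e : A → {η : G // rng η = rng (T.q γ)} := fun η => ⟨β η (p γ), (hin η η.2 γ hγ).2⟩
  have he : Function.Injective e := by
    intro η η' h
    have h' : β η (p γ) = β η' (p γ) := congrArg Subtype.val h
    by_contra hne
    have hne' : (η : G) ≠ η' := fun h => hne (Subtype.ext h)
    refine Set.disjoint_left.1 (hVd η.2 η'.2 hne') (hin η η.2 γ hγ).1.2 ?_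
    rw [h']
    exact (hin η' η'.2 γ hγ).1.2
  rw [← he.tsum_eq, tsum_fintype, ← Finset.sum_coe_sort A]
  · refine Finset.sum_congr rfl fun η _ => ?_
    exact (coord_conv_term f g (τ η γ) (hτq η η.2 γ hγ) (hin η η.2 γ hγ).2 rfl _ _ _).symm
  · intro η hη
    rw [Function.mem_support] at hη
    have hηK : (η : G) ∈ K := by
      by_contra h
      exact hη (by rw [hfK _ h, fiber_zero_mul, coord_zero])
    have hηp : rngU (η : G) = p γ := Subtype.ext η.2
    have : (η : G) ∈ ⋃ η ∈ A, W η := by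
      by_contra h
      exact hγ.1 ⟨η, ⟨hηK, h⟩, hηp⟩
    obtain ⟨a, ha, haW⟩ := Set.mem_iUnion₂.1 this
    exact ⟨⟨a, ha⟩, Subtype.ext (by change β a (p γ) = _; rw [← hηp, hβ a _ haW.1])⟩

theorem conv_mem [T2Space G] {f g : T.Sec} (hf : f ∈ T.Cc) (hg : g ∈ T.Cc) :
    conv f g ∈ T.Cc := by
  refine ⟨isContSec_iff.2 (continuous_fn_conv hf hg.1), ?_⟩
  have hKf : IsCompact (tsupport fun a => ‖f a‖) := hf.2
  have hKg : IsCompact (tsupport fun a => ‖g a‖) := hg.2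
  have hD : IsClosed {p : G × G | src p.1 = rng p.2} :=
    isClosed_eq (continuous_src.comp continuous_fst) (continuous_rng.comp continuous_snd)
  have hQ := ((hKf.prod hKg).inter_right hD).image_of_continuousOn
    (TopGpd.continuousOn_mul.mono Set.inter_subset_right)
  refine HasCompactSupport.intro hQ fun γ hγ => ?_
  by_contra h0
  obtain ⟨η, hr, h1, h2⟩ := exists_of_conv_ne_zero (norm_ne_zero_iff.1 h0)
  refine hγ ⟨(η, mul (inv η) γ), ⟨⟨subset_tsupport _ (norm_ne_zero_iff.2 h1),
    subset_tsupport _ (norm_ne_zero_iff.2 h2)⟩, ?_⟩, mul_inv_cancel_left hr⟩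
  change src η = rng _
  rw [rng_mul _ _ ((src_inv _).trans hr), rng_inv]

variable (T)

/-- The product on `C_c(S; G)` is convolution. -/
instance [T2Space G] : Mul T.Cc := ⟨fun f g => ⟨conv f g, conv_mem f.2 g.2⟩⟩

/-- The involution on `C_c(S; G)`. -/
instance : Star T.Cc := ⟨fun f => ⟨invol f, invol_mem f.2⟩⟩

end Convolution
section ReducedAlgebra

variable {T}

theorem hilb_ext [DecidableEq G] {x : unitSpace G} {A B : T.Hilb x →L[ℂ] T.Hilb x}
    (h : ∀ (ζ : SrcFiber x) (a : T.Fiber (ζ : G)) (γ : SrcFiber x),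
      A (lp.single 2 ζ a) γ = B (lp.single 2 ζ a) γ) : A = B := by
  refine lp.ext_continuousLinearMap ENNReal.ofNat_ne_top fun ζ => ?_
  ext a γ : 3
  exact h ζ a γ

theorem coord_piTerm (f : T.Sec) {x : unitSpace G} (γ ζ : SrcFiber x) (a : T.Fiber (ζ : G))
    (γ' ζ' : S) (hγ : T.q γ' = γ) (hζ : T.q ζ' = ζ) :
    coord γ' hγ (piTerm f γ ζ a) = fn f (mul γ' (inv ζ')) * coord ζ' hζ a := by
  have hs : src γ' = src ζ' := by
    rw [← T.ι_src, ← T.ι_src]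
    congr 2
    exact Subtype.ext (by change src _ = src _; rw [hγ, hζ, γ.2, ζ.2])
  have hs' : src γ' = rng (inv ζ') := hs.trans (rng_inv _).symm
  have hq : T.q (mul γ' (inv ζ')) = quo γ ζ := by
    rw [T.hom_q.map_mul _ _ hs', q_inv, hγ, hζ, quo]
  unfold piTerm
  rw [coord_mul _ _ _ _ (mul γ' (inv ζ')) ζ' γ' hq hζ hγ
    (by rw [src_mul _ _ hs', src_inv]) (inv_mul_cancel_right hs), coord_eq_fn]

theorem piRep_add (x : unitSpace G) (f g : T.Cc) : piRep x (f + g) = piRep x f + piRep x g := by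
  classical
  refine hilb_ext fun ζ a γ => ?_
  rw [_root_.add_apply, lp.coeFn_add, Pi.add_apply, piRep_single, piRep_single,
    piRep_single]
  exact fiber_add_mul _ _ _ _ _

theorem piRep_smul (x : unitSpace G) (c : ℂ) (f : T.Cc) : piRep x (c • f) = c • piRep x f := by
  classical
  refine hilb_ext fun ζ a γ => ?_
  rw [_root_.smul_apply, lp.coeFn_smul, Pi.smul_apply, piRep_single, piRep_single]
  exact fiber_smul_mul _ _ _ _ _

theorem piRep_star (x : unitSpace G) (f : T.Cc) : piRep x (star f) = star (piRep x f) := by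
  classical
  refine hilb_ext fun ζ a γ => ?_
  refine ext_inner_left ℂ fun b => ?_
  have key : ∀ F : T.Hilb x, inner ℂ b (F γ) = inner ℂ (lp.single 2 γ b : T.Hilb x) F :=
    fun F => (lp.inner_single_left γ b F).symm
  refine Eq.trans ?_ (key _).symm
  rw [ContinuousLinearMap.star_eq_adjoint, ContinuousLinearMap.adjoint_inner_right]
  refine Eq.trans ?_ (lp.inner_single_right ζ a (piRep x f (lp.single 2 γ b))).symm
  rw [piRep_single, piRep_single]
  have hγ := T.q_lift (γ : G)
  have hζ := T.q_lift (ζ : G)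
  have hs : src (T.lift (γ : G)) = rng (inv (T.lift (ζ : G))) := by
    rw [rng_inv, ← T.ι_src, ← T.ι_src]
    congr 2
    exact Subtype.ext (by change src _ = src _; rw [hγ, hζ, γ.2, ζ.2])
  rw [inner_eq _ hγ, inner_eq _ hζ, coord_piTerm _ _ _ _ _ _ hγ hζ,
    coord_piTerm _ _ _ _ _ _ hζ hγ]
  have h1 : ((star f : T.Cc) : T.Sec) = invol f := rfl
  rw [h1, fn_invol, inv_mul_rev hs, inv_inv, map_mul]
  ring

theorem composable_lift_quo {x : unitSpace G} (γ ζ : SrcFiber x) :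
    src (T.lift (γ : G)) = rng (inv (T.lift (ζ : G))) := by
  rw [T.composable_iff, q_inv, q_lift, q_lift]
  exact quo_aux γ ζ

theorem q_lift_quo {x : unitSpace G} (γ ζ : SrcFiber x) :
    T.q (mul (T.lift (γ : G)) (inv (T.lift (ζ : G)))) = quo γ ζ := by
  rw [T.hom_q.map_mul _ _ (composable_lift_quo γ ζ), q_inv, q_lift, q_lift, quo]

/-- The bijection `ω ↦ γ ω⁻¹` of `Gx` with the arrows with range `r(γ)`. -/
def quoEquiv {x : unitSpace G} (γ : SrcFiber x) {k : G} (hk : rng k = rng (γ : G)) :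
    SrcFiber x ≃ {η : G // rng η = rng k} where
  toFun ω := ⟨quo γ ω, by rw [rng_quo, hk]⟩
  invFun η := ⟨mul (inv (η : G)) γ, by
    rw [src_mul _ _ (by rw [src_inv, η.2, hk]), γ.2]⟩
  left_inv ω := Subtype.ext (by
    change mul (inv (mul _ _)) _ = _
    rw [inv_mul_rev (quo_aux γ ω), inv_inv, inv_mul_cancel_right (by rw [ω.2, γ.2])])
  right_inv η := Subtype.ext (by
    have h2 : src (inv (η : G)) = rng (γ : G) := by rw [src_inv, η.2, hk]
    change mul _ (inv (mul _ _)) = _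
    rw [inv_mul_rev h2, inv_inv]
    exact mul_inv_cancel_left (η.2.trans hk).symm)

theorem piRep_mul [T2Space G] (x : unitSpace G) (f g : T.Cc) :
    piRep x (f * g) = piRep x f * piRep x g := by
  classical
  refine hilb_ext fun ζ a γ => ?_
  have hγ := T.q_lift (γ : G)
  have hζ := T.q_lift (ζ : G)
  have h1 : ((f * g : T.Cc) : T.Sec) = conv f g := rfl
  apply coord_injective _ hγ
  rw [piRep_single, mul_apply_eq_comp,
    piRep_apply x f (piRep x g (lp.single 2 ζ a)), coord_tsum,
    coord_piTerm _ _ _ _ _ _ hγ hζ, h1]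
  have hs := composable_lift_quo (T := T) γ ζ
  set κ := mul (T.lift (γ : G)) (inv (T.lift (ζ : G))) with hκ
  have hκq : T.q κ = quo γ ζ := q_lift_quo γ ζ
  have hr : rng (T.q κ) = rng (γ : G) := by rw [hκq, rng_quo]
  rw [fn, conv, coord_tsum]
  unfold convTerm
  rw [← (quoEquiv γ hr).tsum_eq, ← tsum_mul_right]
  refine tsum_congr fun ω => ?_
  have hω := T.q_lift (ω : G)
  rw [piRep_single, coord_piTerm _ _ _ _ _ _ hγ hω, coord_piTerm _ _ _ _ _ _ hω hζ, ← mul_assoc]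
  congr 1
  have hs2 := composable_lift_quo (T := T) γ ω
  refine (coord_conv_term (f : T.Sec) (g : T.Sec) _ (q_lift_quo γ ω) ((quoEquiv γ hr) ω).2 rfl
    _ _ _).trans ?_
  congr 2
  rw [inv_mul_rev hs2, inv_inv, assoc _ _ _ ?_ ?_, inv_mul_cancel_left hs]
  · rw [rng_inv, ← rng_inv (T.lift (ω : G)), hs2]
  · rw [src_inv, rng_mul _ _ hs]

variable (T)

/-- The bounded operators on the Hilbert space over `Gx`. -/
abbrev OpAlg (x : unitSpace G) : Type _ := T.Hilb x →L[ℂ] T.Hilb x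

/-- The C⋆-algebra of bounded families of operators on the Hilbert spaces over the `Gx`. -/
def OpFam : Type _ := lp (fun x : unitSpace G => T.OpAlg x) ⊤

instance : NonUnitalCStarAlgebra T.OpFam :=
  inferInstanceAs (NonUnitalCStarAlgebra (lp (fun x : unitSpace G => T.OpAlg x) ⊤))

/-- The direct sum `f ↦ (π_x(f))ₓ` of the regular representations. -/
def regRep : T.Cc →ₗ[ℂ] T.OpFam where
  toFun f := ⟨fun x => piRep x f, memℓp_infty (by
    obtain ⟨C, hC⟩ := exists_norm_piRep_le f
    exact ⟨C, by rintro _ ⟨x, rfl⟩; exact hC x⟩)⟩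
  map_add' f g := Subtype.ext (funext fun x => piRep_add x f g)
  map_smul' c f := Subtype.ext (funext fun x => piRep_smul x c f)

/-- The reduced norm `‖f‖_r = sup_x ‖π_x(f)‖` on `C_c(S; G)`. -/
def redNorm (f : T.Cc) : ℝ := ⨆ x : unitSpace G, ‖piRep x f‖

theorem norm_regRep (f : T.Cc) : ‖T.regRep f‖ = T.redNorm f := rfl

theorem regRep_star (f : T.Cc) : T.regRep (star f) = star (T.regRep f) :=
  Subtype.ext (funext fun x => piRep_star x f)

variable [T2Space G]

theorem regRep_mul (f g : T.Cc) : T.regRep (f * g) = T.regRep f * T.regRep g :=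
  Subtype.ext (funext fun x => piRep_mul x f g)

/-- The image of `C_c(S; G)` under the direct sum of the regular representations. -/
def regImage : NonUnitalStarSubalgebra ℂ T.OpFam where
  carrier := Set.range T.regRep
  add_mem' := by rintro _ _ ⟨f, rfl⟩ ⟨g, rfl⟩; exact ⟨f + g, T.regRep.map_add f g⟩
  zero_mem' := ⟨0, T.regRep.map_zero⟩
  mul_mem' := by rintro _ _ ⟨f, rfl⟩ ⟨g, rfl⟩; exact ⟨f * g, T.regRep_mul f g⟩
  smul_mem' := by rintro c _ ⟨f, rfl⟩; exact ⟨c • f, T.regRep.map_smul c f⟩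
  star_mem' := by rintro _ ⟨f, rfl⟩; exact ⟨star f, T.regRep_star f⟩

/-- The reduced C⋆-algebra: the completion of `C_c(S; G)` in the norm `‖·‖_r`, realized as the
closure of the isometric image of `(C_c(S; G), ‖·‖_r)` in the C⋆-algebra of bounded families of
operators. -/
def CStarRed : Type _ := T.regImage.topologicalClosure

instance : NonUnitalCStarAlgebra T.CStarRed :=
  NonUnitalStarSubalgebra.nonUnitalCStarAlgebra T.regImage.topologicalClosure
    (h_closed := T.regImage.isClosed_topologicalClosure)

/-- The canonical map of `C_c(S; G)` into its completion. -/
def toCStarRed : T.Cc →ₗ[ℂ] T.CStarRed where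
  toFun f := ⟨T.regRep f, T.regImage.le_topologicalClosure ⟨f, rfl⟩⟩
  map_add' f g := Subtype.ext (T.regRep.map_add f g)
  map_smul' c f := Subtype.ext (T.regRep.map_smul c f)

theorem norm_toCStarRed (f : T.Cc) : ‖T.toCStarRed f‖ = T.redNorm f := rfl

theorem toCStarRed_mul (f g : T.Cc) : T.toCStarRed (f * g) = T.toCStarRed f * T.toCStarRed g :=
  Subtype.ext (T.regRep_mul f g)

theorem toCStarRed_star (f : T.Cc) : T.toCStarRed (star f) = star (T.toCStarRed f) :=
  Subtype.ext (T.regRep_star f)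

theorem denseRange_toCStarRed : DenseRange T.toCStarRed := by
  have h : Subtype.val '' Set.range (T.toCStarRed : T.Cc → T.regImage.topologicalClosure) =
      (T.regImage : Set T.OpFam) := (Set.range_comp _ _).symm
  intro a
  exact closure_subtype.2 ((congrArg closure h).ge a.2)

end ReducedAlgebra

end Twist

end

end TwistedGroupoid

/-! An element `a` of the reduced algebra is a bounded family of operators `a_x`, one on each
Hilbert space of square-summable sections over `Gx`. Let `δ_x` be the unit vector that is `[1, x]`
at the unit `x` and zero elsewhere. For `f` in `C_c` the value of `π_x(f) δ_x` at `g` is `f(g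
x⁻¹)[1, x] = f(g)`, so `f` can be read off from its operators (`coeffSec_toCStarRed`). The same
recipe makes sense for every `a`: put `j(a)(g) = (a_x δ_x)(g)` with `x = s(g)`. This is `coeffSec`.

Contractivity is immediate: `j(a)(g)` is one coordinate of the image of a unit vector under an
operator of norm at most `‖a‖` (`norm_coeffSec_le`). Since `C_c` is dense in the reduced algebra,
`j(a)` is a uniform limit of sections in `C_c`, hence continuous and vanishing at infinity
(`coeffSec_mem_C0`).

The central fact is `component_single`: `a_x` sends a vector `b` supported at `ζ` to the section `γ
↦ j(a)(γ ζ⁻¹) b`. It holds on `C_c` by definition of the regular representation, and both sides are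
continuous in `a`. Vectors supported at single points span a dense subspace, so `j(a)` determines
every `a_x`, which is injectivity. The formula for `j(a*)` passes from `C_c` to its closure in the
same way.

The product formula comes from the Hilbert space instead. The vector `b_x δ_x` is the restriction of
`j(b)` to `Gx`, and it is the unconditional ℓ² sum of its one-point parts. Applying the bounded
operator `a_x` and evaluating at `g` keeps the sum unconditional; by the kernel formula its terms
are `j(a)(g ζ⁻¹) j(b)(ζ)`, and `η = g ζ⁻¹` turns it into the convolution sum. Its value is `(a_x b_x
δ_x)(g) = j(ab)(g)`. -/

namespace TwistedGroupoid

open Gpd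

namespace Twist

noncomputable section

variable {S G : Type*} [TopologicalSpace S] [TopologicalSpace G] [TopGpd S] [EtaleGpd G]
  {T : Twist S G}

/-! ### Unit vectors over the units of `G`. -/

section Units

/-- The unit of the groupoid at `x`, as an element of `Gx`. -/
abbrev unitPt (x : unitSpace G) : SrcFiber x := ⟨x, x.2⟩

variable (T) in
/-- The unit vector `[1, x]` in the fibre over the unit `x`. -/
def unitVec (x : unitSpace G) : T.Fiber (x : G) := fmk 1 (T.ι (1, x)) (T.q_ι_unit x)

theorem norm_unitVec (x : unitSpace G) : ‖T.unitVec x‖ = 1 := by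
  rw [norm_eq _ (T.q_ι_unit x), unitVec, coord_fmk, norm_one]

/-- Multiplying by the inverse of a unit changes nothing: `γ x⁻¹ = γ`, and `[1, x]` acts as a right
identity in the line bundle. The comparison is made in coordinates on `S`, where `T.lift γ` itself
serves as a representative of `γ x⁻¹`, so no transport between fibres is needed. -/
theorem piTerm_unitVec (f : T.Sec) {x : unitSpace G} (γ : SrcFiber x) :
    piTerm f γ (unitPt x) (T.unitVec x) = f γ := by
  have hx : src (T.lift (γ : G)) = T.ι (1, x) := by
    rw [← T.ι_src, q_lift]
    congr 2
    exact Subtype.ext γ.2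
  have hm : mul (T.lift (γ : G)) (inv (T.ι (1, x))) = T.lift (γ : G) := by
    rw [inv_unit (T.src_ι 1 x), ← hx, mul_src]
  apply coord_injective _ (T.q_lift (γ : G))
  rw [coord_piTerm f γ (unitPt x) _ _ (T.ι (1, x)) (T.q_lift _) (T.q_ι_unit x), hm, unitVec,
    coord_fmk, mul_one, coord_eq_fn]

variable (T) in
/-- The element of the Hilbert space over `Gx` that is `[1, x]` at the unit and zero elsewhere. -/
def deltaUnit (x : unitSpace G) : T.Hilb x := by
  classical exact lp.single 2 (unitPt x) (T.unitVec x)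

theorem norm_deltaUnit (x : unitSpace G) : ‖T.deltaUnit x‖ = 1 := by
  classical
  exact (lp.norm_single (by norm_num) _ _).trans (norm_unitVec x)

end Units

/-- The summands of `π_x(f)` applied to a section `h` are those of the convolution of `f` and `h`. -/
theorem piTerm_eq_convTerm (f h : T.Sec) {g : G} (ζ : SrcFiber (srcU g)) :
    piTerm f ⟨g, rfl⟩ ζ (h ζ) = convTerm f h g (quoEquiv ⟨g, rfl⟩ rfl ζ) := by
  have hζ : mul (inv (quo (⟨g, rfl⟩ : SrcFiber (srcU g)) ζ)) g = ζ :=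
    congrArg Subtype.val ((quoEquiv (⟨g, rfl⟩ : SrcFiber (srcU g)) rfl).left_inv ζ)
  -- The arrows `ζ` and `(g ζ⁻¹)⁻¹ g` are equal but index different fibre types; among elements of
  -- the line bundle the equality of arrows can be rewritten.
  refine Fiber.ext ?_
  change T.mulL _ (h ζ).val = T.mulL _ (h (mul (inv (quo _ ζ)) g)).val
  rw [hζ]
  rfl

/-! ### Continuity of multiplication and conjugation on the fibres. -/

section FiberContinuity

/-- The norm is multiplicative on products of fibre elements, so multiplication by `b` is an
additive map with bound `‖b‖`. It makes the kernel side of `component_single` continuous in the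
algebra element. -/
theorem continuous_mul_fiber_left {g h k : G} (b : T.Fiber h) (hc : src g = rng h)
    (hk : mul g h = k) : Continuous fun a : T.Fiber g => a.mul b hc hk :=
  AddMonoidHomClass.continuous_of_bound
    (AddMonoidHom.mk' (fun a : T.Fiber g => a.mul b hc hk) fun a a' => fiber_add_mul a a' b hc hk)
    ‖b‖ fun a => (fiber_norm_mul a b hc hk).le.trans (mul_comm _ _).le

/-- In the isometric coordinates given by a representative of `g` and by its inverse in `S`, the
involution is complex conjugation. -/
theorem continuous_conj_fiber {g h : G} (hh : inv g = h) :
    Continuous fun a : T.Fiber g => a.conj hh := by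
  have hq : T.q (inv (T.lift g)) = h := by rw [q_inv, q_lift, hh]
  rw [← (T.coordIso _ hq).toHomeomorph.comp_continuous_iff]
  have : (fun a : T.Fiber g => starRingEnd ℂ (T.coordIso _ (T.q_lift g) a)) =
      (T.coordIso _ hq).toHomeomorph ∘ fun a : T.Fiber g => a.conj hh :=
    funext fun a => (coord_conj a hh _ _ (T.q_lift g) hq rfl).symm
  rw [← this]
  exact Complex.continuous_conj.comp (T.coordIso _ (T.q_lift g)).continuous

end FiberContinuity

/-! ### Components of an algebra element and its coefficient section. -/

section Coefficients

variable [T2Space G]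

variable (T) in
/-- The component at `x` of an element of the reduced C⋆-algebra, an operator on the Hilbert space
over `Gx`. -/
def component (x : unitSpace G) : T.CStarRed →ₗ[ℂ] T.OpAlg x where
  toFun a := (show lp (fun x : unitSpace G => T.OpAlg x) ⊤ from a.1) x
  map_add' _ _ := rfl
  map_smul' _ _ := rfl

theorem norm_component_le (x : unitSpace G) (a : T.CStarRed) : ‖T.component x a‖ ≤ ‖a‖ :=
  lp.norm_apply_le_norm (E := fun x : unitSpace G => T.OpAlg x) ENNReal.top_ne_zero a.1 x

theorem continuous_component (x : unitSpace G) : Continuous (T.component x) :=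
  AddMonoidHomClass.continuous_of_bound (T.component x) 1 fun a => by
    rw [one_mul]; exact norm_component_le x a

/-- Each step `a ↦ a_x ↦ a_x χ ↦ (a_x χ)(γ)` is continuous. Identities between such values therefore
need checking only on the dense image of `C_c`. -/
theorem continuous_component_apply {x : unitSpace G} (χ : T.Hilb x) (γ : SrcFiber x) :
    Continuous fun a => T.component x a χ γ :=
  (lp.lipschitzWith_one_eval 2 γ).continuous.comp
    ((continuous_component x).clm_apply continuous_const)

variable (T) in
/-- The section `g ↦ (a_x δ_x)(g)`, `x = s(g)`, of the line bundle that belongs to an element `a` of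
the reduced C⋆-algebra. -/
def coeffSec : T.CStarRed →ₗ[ℂ] T.Sec where
  toFun a g := T.component (srcU g) a (T.deltaUnit (srcU g)) ⟨g, rfl⟩
  map_add' _ _ := rfl
  map_smul' _ _ := rfl

/-- In `coeffSec` the base point is the source of the arrow. Here `x` is fixed and `γ` runs through
`Gx`, so that `a_x δ_x` is seen, as a single ℓ² vector, to be the restriction of `coeffSec a` to
`Gx`. -/
theorem component_deltaUnit (a : T.CStarRed) {x : unitSpace G} (γ : SrcFiber x) :
    T.component x a (T.deltaUnit x) γ = T.coeffSec a γ := by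
  obtain ⟨γ, hγ⟩ := γ
  obtain rfl : srcU γ = x := Subtype.ext hγ
  rfl

theorem continuous_coeffSec_apply (g : G) : Continuous fun a : T.CStarRed => T.coeffSec a g :=
  continuous_component_apply (T.deltaUnit (srcU g)) ⟨g, rfl⟩

/-- A coordinate of an ℓ² vector is at most its norm, `δ_x` has norm one, and a component of a
bounded family is at most the supremum. -/
theorem norm_coeffSec_le (a : T.CStarRed) (g : G) : ‖T.coeffSec a g‖ ≤ ‖a‖ :=
  calc ‖T.coeffSec a g‖ ≤ ‖T.component (srcU g) a (T.deltaUnit (srcU g))‖ :=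
        lp.norm_apply_le_norm two_ne_zero _ _
    _ ≤ ‖T.component (srcU g) a‖ * ‖T.deltaUnit (srcU g)‖ := ContinuousLinearMap.le_opNorm _ _
    _ ≤ ‖a‖ := by rw [norm_deltaUnit, mul_one]; exact norm_component_le _ _

/-- Applied to a vector supported at one point, `π_x(f)` gives a single term; at the unit this term
is `f(g x⁻¹)[1, x] = f(g)`. -/
theorem coeffSec_toCStarRed (f : T.Cc) : T.coeffSec (T.toCStarRed f) = f := by
  classical
  funext g
  change piRep (srcU g) f (lp.single 2 _ _) _ = _
  rw [piRep_single, piTerm_unitVec]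

/-- Elements of the reduced C⋆-algebra have sections that are uniformly approximated by `C_c`. -/
theorem exists_norm_coeffSec_sub_lt (a : T.CStarRed) {ε : ℝ} (hε : 0 < ε) :
    ∃ f : T.Cc, ∀ g, ‖T.coeffSec a g - (f : T.Sec) g‖ < ε := by
  obtain ⟨f, hf⟩ := Metric.denseRange_iff.1 T.denseRange_toCStarRed a ε hε
  refine ⟨f, fun g => ?_⟩
  have h := norm_coeffSec_le (a - T.toCStarRed f) g
  rw [map_sub, coeffSec_toCStarRed] at h
  exact h.trans_lt (by rwa [← dist_eq_norm])

theorem coeffSec_mem_C0 (a : T.CStarRed) : T.coeffSec a ∈ T.C0 := by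
  constructor
  -- Values of a section at different arrows lie in different fibres, so the uniform limit theorem
  -- is applied to the associated scalar functions on `S`.
  · refine isContSec_iff.2 (continuous_of_uniform_approx_of_continuous fun u hu => ?_)
    obtain ⟨ε, hε, hεu⟩ := Metric.mem_uniformity_dist.1 hu
    obtain ⟨f, hf⟩ := exists_norm_coeffSec_sub_lt a hε
    refine ⟨fn (f : T.Sec), isContSec_iff.1 f.2.1, fun γ => hεu ?_⟩
    -- The coordinate with respect to `γ` is a linear isometry from the fibre over `q γ` onto `ℂ`,
    -- so uniform closeness of sections is uniform closeness of functions.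
    refine (le_of_eq ?_).trans_lt (hf (T.q γ))
    rw [dist_eq_norm, norm_eq γ rfl]
    exact congrArg norm ((T.coordLin γ rfl).map_sub _ _).symm
  · rw [Metric.tendsto_nhds]
    intro ε hε
    -- One half of `ε` is spent on approximating by `f`, the other on the smallness of `f` outside a
    -- compact set.
    obtain ⟨f, hf⟩ := exists_norm_coeffSec_sub_lt a (half_pos hε)
    filter_upwards [Metric.tendsto_nhds.1 (T.Cc_le_C0 f.2).2 (ε / 2) (half_pos hε)] with g hg
    rw [dist_zero_right, norm_norm] at hg ⊢
    have := norm_le_norm_sub_add (T.coeffSec a g) ((f : T.Sec) g)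
    linarith [hf g]

/-! ### The kernel of `a_x`, and what it gives for injectivity, involution and product. -/

/-- The operator `a_x` is given by the kernel `(γ, ζ) ↦ coeffSec a (γ ζ⁻¹)`. -/
theorem component_single [DecidableEq G] (a : T.CStarRed) {x : unitSpace G} (ζ γ : SrcFiber x)
    (b : T.Fiber (ζ : G)) :
    T.component x a (lp.single 2 ζ b) γ = piTerm (T.coeffSec a) γ ζ b := by
  -- For fixed `ζ`, `γ`, `b` both sides are continuous in `a`: the left is a value of `a_x` on a
  -- fixed vector, the right is one value of `coeffSec a` multiplied by `b`. They agree on the image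
  -- of `C_c`.
  refine congrFun (T.denseRange_toCStarRed.equalizer (continuous_component_apply _ γ)
    ((continuous_mul_fiber_left b (src_quo γ ζ) (quo_mul γ ζ)).comp
      (continuous_coeffSec_apply (quo γ ζ))) (funext fun f => ?_)) a
  change piRep x f _ _ = piTerm (T.coeffSec (T.toCStarRed f)) γ ζ b
  rw [piRep_single, coeffSec_toCStarRed]

/-- A bounded operator is determined by its values on vectors supported at single points
(`hilb_ext`), and by `component_single` these depend only on the coefficient section. -/
theorem coeffSec_injective : Function.Injective T.coeffSec := by
  classical
  intro a b h
  refine Subtype.ext (Subtype.ext (funext fun x => hilb_ext fun ζ c γ => ?_))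
  change T.component x a _ γ = T.component x b _ γ
  rw [component_single, component_single, h]

/-- On `C_c` this is the definition of the involution. The star operation, conjugation of fibres and
evaluation of coefficients are continuous, so it extends by density. -/
theorem coeffSec_star (a : T.CStarRed) (g : G) :
    T.coeffSec (star a) g = (T.coeffSec a (inv g)).conj (inv_inv g) := by
  refine congrFun (T.denseRange_toCStarRed.equalizer
    ((continuous_coeffSec_apply g).comp continuous_star)
    ((continuous_conj_fiber (inv_inv g)).comp (continuous_coeffSec_apply (inv g)))
    (funext fun f => ?_)) a
  change T.coeffSec (star (T.toCStarRed f)) g = (T.coeffSec (T.toCStarRed f) _).conj (inv_inv g)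
  rw [← toCStarRed_star, coeffSec_toCStarRed, coeffSec_toCStarRed]
  rfl

/-- Unconditional convergence is inherited from the ℓ² expansion of `b_x δ_x`, `x = s(g)`, through
the bounded operator `a_x` and evaluation at `g`. No density argument in `a` or `b` is made for the
infinite sum itself. -/
theorem hasSum_convTerm_coeffSec (a b : T.CStarRed) (g : G) :
    HasSum (convTerm (T.coeffSec a) (T.coeffSec b) g) (T.coeffSec (a * b) g) := by
  classical
  let γ : SrcFiber (srcU g) := ⟨g, rfl⟩
  -- Substitute `η = g ζ⁻¹`, so that the sum runs over `ζ` in `Gx`, the index set of the ℓ² space.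
  rw [← (quoEquiv γ rfl).hasSum_iff]
  have h := lp.hasSum_single ENNReal.ofNat_ne_top (T.component (srcU g) b (T.deltaUnit (srcU g)))
  have h' := (h.mapL (T.component (srcU g) a)).map
    (AddMonoidHom.mk' (fun χ : T.Hilb (srcU g) => χ γ) fun _ _ => rfl)
    (lp.lipschitzWith_one_eval 2 γ).continuous
  -- The two sums have the same value by definition, since products of families are formed
  -- componentwise: `(ab)_x δ_x = a_x (b_x δ_x)`. Only the summands remain to be matched.
  refine (congrArg (fun t => HasSum t (T.coeffSec (a * b) g)) (funext fun ζ => ?_)).mp h'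
  change T.component (srcU g) a (lp.single 2 ζ _) γ = _
  rw [component_single, component_deltaUnit]
  exact piTerm_eq_convTerm _ _ ζ

end Coefficients

end

end Twist

end TwistedGroupoid

/-- The first two clauses determine `j`: it is prescribed on the dense image of `C_c`, and the norm
bound makes it continuous. `HasSum` over the arrows `η` with the same range as `g` is unconditional
convergence in the fibre over `g`. -/
theorem mainTheorem8 {S G : Type*} [TopologicalSpace S] [LocallyCompactSpace S] [T2Space S]
    [TopologicalSpace G] [LocallyCompactSpace G] [T2Space G]
    [TwistedGroupoid.TopGpd S] [TwistedGroupoid.EtaleGpd G] (T : TwistedGroupoid.Twist S G) :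
    ∃ j : T.CStarRed →ₗ[ℂ] T.C0,
      (∀ f : T.Cc, j (T.toCStarRed f) = T.inclusionCc f) ∧
      (∀ a : T.CStarRed, ‖j a‖ ≤ ‖a‖) ∧
      Function.Injective j ∧
      (∀ (a : T.CStarRed) (g : G), (j (star a) : T.Sec) g =
        ((j a : T.Sec) (TwistedGroupoid.Gpd.inv g)).conj (TwistedGroupoid.inv_inv g)) ∧
      ∀ (a b : T.CStarRed) (g : G),
        HasSum (TwistedGroupoid.Twist.convTerm (j a : T.Sec) (j b : T.Sec) g)
          ((j (a * b) : T.Sec) g) := by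
  refine ⟨T.coeffSec.codRestrict T.C0 TwistedGroupoid.Twist.coeffSec_mem_C0, fun f => ?_,
    fun a => ?_, ?_, TwistedGroupoid.Twist.coeffSec_star,
    TwistedGroupoid.Twist.hasSum_convTerm_coeffSec⟩
  · exact Subtype.ext (TwistedGroupoid.Twist.coeffSec_toCStarRed f)
  · exact TwistedGroupoid.Twist.C0_norm_le (norm_nonneg a)
      (TwistedGroupoid.Twist.norm_coeffSec_le a)
  · exact fun a b h => TwistedGroupoid.Twist.coeffSec_injective (congrArg Subtype.val h)
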